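/- **Setting.** Let $M_A,M_B>0$ and $c_A,c_B\in(0,1)$. For $p\in\mathbb R$ and $R_A,R_B\ge 0$, consider the constant-sum General Lotto game with favoritism on a single battlefield of unit value: player $i\in\{A,B\}$ chooses a probability distribution $F_i$ on $[0,\infty)$ with mean at most $R_i$, player $A$'s payoff is $\Pr[x_A+p\ge x_B]$ with $x_A\sim F_A$, $x_B\sim F_B$ independent, and $B$'s payoff is one minus that. Let $\pi_A^*(p,R_A,R_B)=\sup_{F_A}\inf_{F_B}\Pr[x_A+p\ge x_B]$, which is $A$'s payoff in every Nash equilibrium. In the Stackelberg game, $A$ first chooses a pre-allocation $p_A\in[0,M_A/c_A]$, then $B$, having observed it, chooses $p_B\in[0,M_B/c_B]$, and the payoffs are $$u_A(p_A,p_B)=\pi_A^*(p_A-p_B,\;M_A-c_Ap_A,\;M_B-c_Bp_B),\qquad u_B=1-u_A .$$ A pair $(p_A^*,p_B^*)$ is a *Stackelberg equilibrium* if $p_A^*$ maximizes $\inf_{p_B\in[0,M_B/c_B]}u_A(p_A,p_B)$ over $p_A\in[0,M_A/c_A]$, and $p_B^*$ minimizes $u_A(p_A^*,p_B)$ over $p_B\in[0,M_B/c_B]$.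 Put $$\bar p_A=\frac{2(1-c_A)}{2-c_A}\,\frac{M_A}{c_A},\qquad \hat p_B(p_A)=\frac{M_B}{c_B}-\frac{M_B-c_Bp_A}{2-c_B}.$$ An *indifference threshold* is a $p_A\in(0,M_A/c_A]$ with $\hat p_B(p_A)\in[0,M_B/c_B]$ and $u_B(p_A,0)=u_B(p_A,\hat p_B(p_A))$. **Proposition.** 0. If $\frac{M_B}{c_B}\le\frac{M_A}{c_A}$, then $(P,R)=(\bar p_A,\,M_A-c_A\bar p_A)$ is the unique maximizer of $\pi_A^*(P,R,M_B)$ over all $P,R\ge0$ with $R+c_AP\le M_A$; that is, $\bar p_A$ is $A$'s optimal investment when $B$ does not pre-allocate. 1. If $\frac{M_B}{c_B}\le M_A$, the unique Stackelberg equilibrium is $(p_A^*,p_B^*)=(\bar p_A,0)$. 2. If $M_A<\frac{M_B}{c_B}<\frac{M_A}{c_A}$, there is exactly one indifference threshold $p_A^\dagger$. If $p_A^\dagger<\bar p_A$, the unique Stackelberg equilibrium is $(\bar p_A,0)$. If $p_A^\dagger\ge\bar p_A$, the Stackelberg equilibria are exactly $(p_A^\dagger,0)$ and $(p_A^\dagger,\hat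 p_B(p_A^\dagger))$. If $\frac{M_B}{c_B}=\frac{M_A}{c_A}$, there is at most one indifference threshold; if $p_A^\dagger$ is one, then $p_A^\dagger\ge\bar p_A$, and $(p_A^\dagger,0)$ and $(p_A^\dagger,\hat p_B(p_A^\dagger))$ are Stackelberg equilibria. 3. If $\frac{M_A}{c_A}<\frac{M_B}{c_B}$, the unique Stackelberg equilibrium is $(0,\hat p_B(0))$. -/

import Mathlib

open scoped NNReal ENNReal
open MeasureTheory

noncomputable section

namespace Lotto

/-- Strategies in the single-battlefield General Lotto game: probability distributions of a
nonnegative allocation whose expected value does not exceed the budget `R`. -/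
def Strategy (R : ℝ) : Type :=
  {F : ProbabilityMeasure ℝ≥0 // ∫⁻ x, (x : ℝ≥0∞) ∂(F : Measure ℝ≥0) ≤ ENNReal.ofReal R}

/-- Expected payoff of player `A` with favoritism `p` (in favor of `A` when `p > 0`, of `B` when
`p < 0`), on one battlefield of unit value: the probability that `x_A + p ≥ x_B` when `x_A` and
`x_B` are drawn independently from the two strategies. -/
def payoffA (p : ℝ) {RA RB : ℝ} (FA : Strategy RA) (FB : Strategy RB) : ℝ :=
  ((FA.1 : Measure ℝ≥0).prod (FB.1 : Measure ℝ≥0)).real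
    {z : ℝ≥0 × ℝ≥0 | (z.2 : ℝ) ≤ (z.1 : ℝ) + p}

/-- Nash equilibrium of the (constant-sum) General Lotto game with favoritism; `B` receives
`1 - payoffA`. -/
def IsNash (p : ℝ) {RA RB : ℝ} (FA : Strategy RA) (FB : Strategy RB) : Prop :=
  (∀ FA' : Strategy RA, payoffA p FA' FB ≤ payoffA p FA FB) ∧
  (∀ FB' : Strategy RB, 1 - payoffA p FA FB' ≤ 1 - payoffA p FA FB)

/-- Player `A`'s equilibrium payoff `π_A^*(p, R_A, R_B)`, as the value of the constant-sum game.
It is the payoff of every Nash equilibrium (`IsNash.payoffA_eq_eqPayoffA`), and it also covers the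
degenerate zero budgets, for which the value need not be attained. -/
def eqPayoffA (p RA RB : ℝ) : ℝ :=
  ⨆ FA : Strategy RA, ⨅ FB : Strategy RB, payoffA p FA FB

theorem payoffA_nonneg (p : ℝ) {RA RB : ℝ} (FA : Strategy RA) (FB : Strategy RB) :
    0 ≤ payoffA p FA FB := measureReal_nonneg

theorem payoffA_le_one (p : ℝ) {RA RB : ℝ} (FA : Strategy RA) (FB : Strategy RB) :
    payoffA p FA FB ≤ 1 := measureReal_le_one

theorem IsNash.payoffA_eq_eqPayoffA {p RA RB : ℝ} {FA : Strategy RA} {FB : Strategy RB}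
    (h : IsNash p FA FB) : payoffA p FA FB = eqPayoffA p RA RB := by
  have hbelow : ∀ FA' : Strategy RA,
      BddBelow (Set.range fun FB' : Strategy RB => payoffA p FA' FB') :=
    fun FA' => ⟨0, by rintro _ ⟨FB', rfl⟩; exact payoffA_nonneg p FA' FB'⟩
  have : Nonempty (Strategy RA) := ⟨FA⟩
  have : Nonempty (Strategy RB) := ⟨FB⟩
  apply le_antisymm
  · have h1 : payoffA p FA FB ≤ ⨅ FB' : Strategy RB, payoffA p FA FB' :=
      le_ciInf fun FB' => by linarith [h.2 FB']
    refine h1.trans (le_ciSup (f := fun FA' : Strategy RA =>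
      ⨅ FB' : Strategy RB, payoffA p FA' FB') ⟨1, ?_⟩ FA)
    rintro _ ⟨FA', rfl⟩
    exact (ciInf_le (hbelow FA') FB).trans (payoffA_le_one p FA' FB)
  · exact ciSup_le fun FA' => (ciInf_le (hbelow FA') FB).trans (h.1 FA')

/-- `(P, R)` solves player `A`'s investment problem against real-time resources `RB`: it maximizes
`π_A^*(P, R, RB)` over all `P, R ≥ 0` with `R + cA * P ≤ MA`. -/
def IsOptimalInvestment (MA cA RB P R : ℝ) : Prop :=
  (0 ≤ P ∧ 0 ≤ R ∧ R + cA * P ≤ MA) ∧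
  ∀ P' R' : ℝ, 0 ≤ P' → 0 ≤ R' → R' + cA * P' ≤ MA → eqPayoffA P' R' RB ≤ eqPayoffA P R RB

/-- The pre-allocation `2(1 - c_A)/(2 - c_A) * M_A/c_A`. -/
def pBar (MA cA : ℝ) : ℝ := 2 * (1 - cA) / (2 - cA) * (MA / cA)

/-- Final payoff `u_A(p_A, p_B)` of player `A` in the Stackelberg game. -/
def uA (MA cA MB cB pA pB : ℝ) : ℝ :=
  eqPayoffA (pA - pB) (MA - cA * pA) (MB - cB * pB)

/-- Final payoff `u_B(p_A, p_B)` of player `B` in the Stackelberg game. -/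
def uB (MA cA MB cB pA pB : ℝ) : ℝ := 1 - uA MA cA MB cB pA pB

/-- Stackelberg equilibrium: `pA` maximizes over `[0, MA/cA]` the worst-case payoff
`inf_{p_B} u_A(·, p_B)`, and `pB` is a minimizer of `u_A(pA, ·)` over `[0, MB/cB]`. -/
def IsStackelberg (MA cA MB cB pA pB : ℝ) : Prop :=
  (pA ∈ Set.Icc 0 (MA / cA) ∧
    IsMaxOn (fun q => sInf (uA MA cA MB cB q '' Set.Icc 0 (MB / cB)))
      (Set.Icc 0 (MA / cA)) pA) ∧
  (pB ∈ Set.Icc 0 (MB / cB) ∧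
    IsMinOn (fun q => uA MA cA MB cB pA q) (Set.Icc 0 (MB / cB)) pB)

/-- The response `p̂_B` to the pre-allocation `pA`. -/
def pHat (MB cB pA : ℝ) : ℝ := MB / cB - (MB - cB * pA) / (2 - cB)

/-- `pA ∈ (0, MA/cA]` is an indifference threshold: `p̂_B` is a feasible response to `pA`, and `B`
is indifferent between it and not responding. -/
def IsIndifference (MA cA MB cB pA : ℝ) : Prop :=
  pA ∈ Set.Ioc 0 (MA / cA) ∧ pHat MB cB pA ∈ Set.Icc 0 (MB / cB) ∧
  uB MA cA MB cB pA 0 = uB MA cA MB cB pA (pHat MB cB pA)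

end Lotto

end

/-! When one player has a head start `p` and budget `x`, and the other has budget `y`, the value of
the Lotto game is explicit (`headStartValue`). The law mixing an atom at zero with a uniform part
has a CDF with an affine majorant. Integrating that majorant against the opponent's law uses only
the opponent's mean, so it bounds the payoff against every strategy. The two players' bounds meet,
up to `ε`. With `U = supportTop p x`, the value is `1 - y / U` for `y ≤ (p + U) / 2` and `x / (2 *
(y - p))` beyond.

The rest is analysis in one variable, resting on two facts. First, `supportTop` is concave and
homogeneous. Second, `(p - (1 - c) * U) ^ 2 = 2 * U * (x + c * p) - c * (2 - c) * U ^ 2`, so under a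
budget `x + c * p ≤ M` the top `U` is largest exactly at `pBar`. This gives `A`'s optimal
investment, and also `B`'s best way to overshoot `A`: `pHat` is `A`'s pre-allocation plus the `pBar`
of what `B` has left after neutralizing it.

Reducing `A`'s head start only partly is dominated, because an affine over a concave function is
quasi-convex (`headStartValue_response`). So `B` chooses between `0` and `pHat`, leaving `A` with
`uA a 0` or `offsetValue`; a `B` too poor to offset chooses `0`.

In `a`, `offsetValue` is a Möbius function, increasing, constant or decreasing according to the sign
of `cB * MA - cA * MB`, and `uA a 0` falls beyond `pBar`. In the middle range `uA a 0 - offsetValue`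
is concave where the first formula holds, and positive before that, so it changes sign once
(`headStartValue_lt_offsetValue_of_lt`). `A` thus secures `offsetValue` up to the threshold and `uA
a 0` after it, and the maximum sits at the larger of `pBar` and the threshold. If `B` is strong,
`offsetValue` decreases and `A` pre-allocates nothing. -/

noncomputable section

namespace Lotto

/-! ### Security strategies and affine bounds on payoffs. -/

/-- The distribution with mass `1 - w` at `0` and the remaining mass `w` uniform on
`[l, l + h]`. -/
def atomUniform (w l h : ℝ) : Measure ℝ≥0 :=
  ENNReal.ofReal (1 - w) • Measure.dirac 0 +
    ENNReal.ofReal w •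
      (volume.restrict (Set.Icc (0 : ℝ) 1)).map (fun u : ℝ => (l + h * u).toNNReal)

theorem measurable_affine_toNNReal (l h : ℝ) :
    Measurable (fun u : ℝ => (l + h * u).toNNReal) := by fun_prop

theorem isProbabilityMeasure_atomUniform {w l h : ℝ} (hw : 0 ≤ w) (hw1 : w ≤ 1) :
    IsProbabilityMeasure (atomUniform w l h) := by
  refine ⟨?_⟩
  rw [atomUniform, Measure.add_apply, Measure.smul_apply, Measure.smul_apply,
    Measure.map_apply (measurable_affine_toNNReal l h) MeasurableSet.univ]
  simp only [measure_univ, Set.preimage_univ, Measure.restrict_apply_univ, Real.volume_Icc,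
    sub_zero, ENNReal.ofReal_one, smul_eq_mul, mul_one]
  rw [← ENNReal.ofReal_add (by linarith) hw]
  simp

theorem lintegral_atomUniform {w l h : ℝ} (hw : 0 ≤ w) (hl : 0 ≤ l) (hh : 0 ≤ h) :
    ∫⁻ x, (x : ℝ≥0∞) ∂(atomUniform w l h) = ENNReal.ofReal (w * (l + h / 2)) := by
  rw [atomUniform, lintegral_add_measure, lintegral_smul_measure, lintegral_smul_measure,
    lintegral_map (by fun_prop) (measurable_affine_toNNReal l h)]
  have key : ∫⁻ u in Set.Icc (0 : ℝ) 1, (((l + h * u).toNNReal : ℝ≥0) : ℝ≥0∞)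
      = ENNReal.ofReal (l + h / 2) := by
    have hint : IntegrableOn (fun u : ℝ => l + h * u) (Set.Icc 0 1) :=
      (by fun_prop : Continuous fun u : ℝ => l + h * u).integrableOn_Icc
    have := ofReal_integral_eq_lintegral_ofReal hint
      ((ae_restrict_iff' measurableSet_Icc).2 (ae_of_all _ fun u hu => by
        have := hu.1
        simp only [Pi.zero_apply]; positivity))
    rw [integral_Icc_eq_integral_Ioc, ← intervalIntegral.integral_of_le zero_le_one] at this
    simp only [ENNReal.ofReal] at this ⊢
    rw [← this, intervalIntegral.integral_add intervalIntegrable_const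
      ((by fun_prop : Continuous fun u : ℝ => h * u).intervalIntegrable _ _),
      intervalIntegral.integral_const, intervalIntegral.integral_const_mul, integral_id]
    norm_num [div_eq_mul_inv]
  rw [key]
  simp only [lintegral_dirac, ENNReal.coe_zero, mul_zero, zero_add, smul_eq_mul]
  rw [← ENNReal.ofReal_mul hw]

/-- Only majorants are needed, so the uniform part is not capped above `l + h`; the bound is then
affine for `t ≥ l`. -/
theorem atomUniform_real_le {w l h : ℝ} (hw : 0 ≤ w) (hw1 : w ≤ 1) (hl : 0 ≤ l) (hh : 0 < h)
    (t : ℝ) :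
    (atomUniform w l h).real {x : ℝ≥0 | (x : ℝ) ≤ t} ≤ 1 - w + w * max 0 ((t - l) / h) := by
  have hm : MeasurableSet {x : ℝ≥0 | (x : ℝ) ≤ t} :=
    measurableSet_le (by fun_prop) measurable_const
  have hnn : 0 ≤ w * max 0 ((t - l) / h) := mul_nonneg hw (le_max_left _ _)
  refine ENNReal.toReal_le_of_le_ofReal (by linarith) ?_
  rw [atomUniform, Measure.add_apply, Measure.smul_apply, Measure.smul_apply,
    Measure.map_apply (measurable_affine_toNNReal l h) hm, smul_eq_mul, smul_eq_mul,
    ENNReal.ofReal_add (by linarith) hnn, ENNReal.ofReal_mul hw]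
  gcongr
  · exact mul_le_of_le_one_right (by simp) prob_le_one
  · rw [Measure.restrict_apply (measurable_affine_toNNReal l h hm)]
    have hsub : ((fun u : ℝ => (l + h * u).toNNReal) ⁻¹' {x : ℝ≥0 | (x : ℝ) ≤ t}) ∩
        Set.Icc (0 : ℝ) 1 ⊆ Set.Icc 0 ((t - l) / h) := by
      rintro u ⟨hu, hu0, -⟩
      refine ⟨hu0, ?_⟩
      have h1 : ((l + h * u).toNNReal : ℝ) ≤ t := hu
      rw [Real.coe_toNNReal _ (by positivity)] at h1
      rw [le_div_iff₀ hh]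
      linarith
    refine (measure_mono hsub).trans ?_
    rw [Real.volume_Icc, sub_zero]
    exact ENNReal.ofReal_le_ofReal (le_max_right _ _)

theorem atomUniform_real_of_neg {w l h : ℝ} {t : ℝ} (ht : t < 0) :
    (atomUniform w l h).real {x : ℝ≥0 | (x : ℝ) ≤ t} = 0 := by
  have : {x : ℝ≥0 | (x : ℝ) ≤ t} = ∅ := by
    ext x
    have := x.coe_nonneg
    simp only [Set.mem_ofPred_eq, Set.mem_empty_iff_false, iff_false, not_le]
    linarith
  rw [this, measureReal_empty]

/-- The strategy given by `atomUniform`. -/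
def atomUniformStrategy {w l h R : ℝ} (hw : 0 ≤ w) (hw1 : w ≤ 1) (hl : 0 ≤ l) (hh : 0 ≤ h)
    (hR : w * (l + h / 2) ≤ R) : Strategy R :=
  ⟨⟨atomUniform w l h, isProbabilityMeasure_atomUniform hw hw1⟩, by
    simpa only [ProbabilityMeasure.coe_mk, lintegral_atomUniform hw hl hh] using
      ENNReal.ofReal_le_ofReal hR⟩

theorem measurableSet_win (p : ℝ) :
    MeasurableSet {z : ℝ≥0 × ℝ≥0 | (z.2 : ℝ) ≤ (z.1 : ℝ) + p} :=
  measurableSet_le (by fun_prop) (by fun_prop)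

/-- The law enters only through its mean, which is at most `R`; `0 ≤ β` makes the bound monotone in
that mean. -/
theorem lintegral_le_of_affine {R α β : ℝ} (F : Strategy R) (hR : 0 ≤ R) (hα : 0 ≤ α)
    (hβ : 0 ≤ β) {φ : ℝ≥0 → ℝ≥0∞} (hφ : ∀ y : ℝ≥0, φ y ≤ ENNReal.ofReal (α + β * y)) :
    ∫⁻ y, φ y ∂(F.1 : Measure ℝ≥0) ≤ ENNReal.ofReal (α + β * R) := by
  calc ∫⁻ y, φ y ∂(F.1 : Measure ℝ≥0)
      ≤ ∫⁻ y, (ENNReal.ofReal α + ENNReal.ofReal β * (y : ℝ≥0∞)) ∂(F.1 : Measure ℝ≥0) := by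
        refine lintegral_mono fun y => (hφ y).trans_eq ?_
        rw [ENNReal.ofReal_add hα (by positivity), ENNReal.ofReal_mul hβ]
        simp
    _ = ENNReal.ofReal α + ENNReal.ofReal β * ∫⁻ y, (y : ℝ≥0∞) ∂(F.1 : Measure ℝ≥0) := by
        rw [lintegral_add_left measurable_const, lintegral_const_mul _ (by fun_prop)]
        simp
    _ ≤ ENNReal.ofReal α + ENNReal.ofReal β * ENNReal.ofReal R := by
        gcongr
        exact F.2
    _ = _ := by rw [ENNReal.ofReal_add hα (by positivity), ENNReal.ofReal_mul hβ]

/-- An affine bound on the distribution of `B` bounds the payoff of `A` from above. -/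
theorem payoffA_le_of_affine {p RA RB α β : ℝ} (hRA : 0 ≤ RA) (hα : 0 ≤ α) (hβ : 0 ≤ β)
    {FB : Strategy RB}
    (h : ∀ y : ℝ, 0 ≤ y → (FB.1 : Measure ℝ≥0).real {x : ℝ≥0 | (x : ℝ) ≤ y + p} ≤ α + β * y)
    (FA : Strategy RA) : payoffA p FA FB ≤ α + β * RA := by
  refine ENNReal.toReal_le_of_le_ofReal (by positivity) ?_
  rw [Measure.prod_apply (measurableSet_win p)]
  refine lintegral_le_of_affine FA hRA hα hβ fun y => ?_
  rw [← ENNReal.ofReal_toReal (measure_ne_top (FB.1 : Measure ℝ≥0) _)]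
  exact ENNReal.ofReal_le_ofReal (h y y.2)

/-- An affine bound on the distribution of `A` bounds the payoff of `A` from below. -/
theorem le_payoffA_of_affine {p RA RB α β : ℝ} (hRB : 0 ≤ RB) (hα : 0 ≤ α) (hβ : 0 ≤ β)
    {FA : Strategy RA}
    (h : ∀ y : ℝ, 0 ≤ y → (FA.1 : Measure ℝ≥0).real {x : ℝ≥0 | (x : ℝ) ≤ y - p} ≤ α + β * y)
    (FB : Strategy RB) : 1 - (α + β * RB) ≤ payoffA p FA FB := by
  have hc := probReal_compl_eq_one_sub
    (μ := (FA.1 : Measure ℝ≥0).prod (FB.1 : Measure ℝ≥0)) (measurableSet_win p)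
  have hle : ((FA.1 : Measure ℝ≥0).prod (FB.1 : Measure ℝ≥0)).real
      {z : ℝ≥0 × ℝ≥0 | (z.2 : ℝ) ≤ (z.1 : ℝ) + p}ᶜ ≤ α + β * RB := by
    refine ENNReal.toReal_le_of_le_ofReal (by positivity) ?_
    rw [Measure.prod_apply_symm (measurableSet_win p).compl]
    refine lintegral_le_of_affine FB hRB hα hβ fun y => ?_
    refine (measure_mono (t := {x : ℝ≥0 | (x : ℝ) ≤ y - p}) ?_).trans ?_
    · intro x hx
      simp only [Set.mem_preimage, Set.mem_compl_iff, Set.mem_ofPred_eq, not_le] at hx ⊢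
      linarith
    · rw [← ENNReal.ofReal_toReal (measure_ne_top (FA.1 : Measure ℝ≥0) _)]
      exact ENNReal.ofReal_le_ofReal (h y y.2)
  rw [hc] at hle
  unfold payoffA
  linarith

instance (R : ℝ) : Nonempty (Strategy R) :=
  ⟨⟨⟨Measure.dirac 0, inferInstance⟩, by simp⟩⟩

theorem eqPayoffA_le {p RA RB v : ℝ} (FB : Strategy RB)
    (h : ∀ FA : Strategy RA, payoffA p FA FB ≤ v) : eqPayoffA p RA RB ≤ v :=
  ciSup_le fun FA => (ciInf_le ⟨0, by rintro _ ⟨FB', rfl⟩; exact payoffA_nonneg p FA FB'⟩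
    FB).trans (h FA)

theorem le_eqPayoffA {p RA RB v : ℝ} (FA : Strategy RA)
    (h : ∀ FB : Strategy RB, v ≤ payoffA p FA FB) : v ≤ eqPayoffA p RA RB := by
  refine (le_ciInf h).trans (le_ciSup (f := fun FA' : Strategy RA =>
      ⨅ FB' : Strategy RB, payoffA p FA' FB') ⟨1, ?_⟩ FA)
  rintro _ ⟨FA', rfl⟩
  obtain ⟨FB⟩ := (inferInstance : Nonempty (Strategy RB))
  exact (ciInf_le ⟨0, by rintro _ ⟨FB', rfl⟩; exact payoffA_nonneg p FA' FB'⟩ FB).trans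
    (payoffA_le_one p FA' FB)

/-! ### The value of the game with a head start. -/

/-- The largest point `U` of the support in the Lotto game in which the player with budget `x`
has the head start `p`. -/
def supportTop (p x : ℝ) : ℝ := x + p + √(x * (x + 2 * p))

/-- The equilibrium payoff of a player with head start `p ≥ 0` and budget `x` against an opponent
with budget `y`. -/
def headStartValue (p x y : ℝ) : ℝ :=
  if y ≤ (p + supportTop p x) / 2 then 1 - y / supportTop p x else x / (2 * (y - p))

section supportTop

variable {p x : ℝ}

/-- For `U > 0` this is `(U - p) ^ 2 / (2 * U) = x`: an atom `p / U` at zero with density `1 / U` on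
`[0, U - p]` has mean `x`. -/
theorem supportTop_sq (hp : 0 ≤ p) (hx : 0 ≤ x) :
    supportTop p x ^ 2 + p ^ 2 = 2 * supportTop p x * (x + p) := by
  have := Real.sq_sqrt (show 0 ≤ x * (x + 2 * p) by positivity)
  unfold supportTop
  linear_combination this

theorem le_sqrt_supportTop (hp : 0 ≤ p) (hx : 0 ≤ x) : x ≤ √(x * (x + 2 * p)) :=
  Real.le_sqrt_of_sq_le (by nlinarith [mul_nonneg hx hp])

theorem add_le_supportTop (hp : 0 ≤ p) (hx : 0 ≤ x) : 2 * x + p ≤ supportTop p x := by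
  have := le_sqrt_supportTop hp hx
  unfold supportTop
  linarith

end supportTop

/-- Security strategy of the player with the head start. -/
theorem exists_strategy_headStart {p x y : ℝ} (hp : 0 ≤ p) (hx : 0 ≤ x)
    (h0 : 0 < p ∨ 0 < x ∨ 0 < y) :
    ∃ F : Strategy x, ∃ α β : ℝ, 0 ≤ α ∧ 0 ≤ β ∧
      (∀ z : ℝ, 0 ≤ z → (F.1 : Measure ℝ≥0).real {t : ℝ≥0 | (t : ℝ) ≤ z - p} ≤ α + β * z) ∧
      α + β * y = 1 - headStartValue p x y := by
  have hU := add_le_supportTop hp hx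
  have hq := supportTop_sq hp hx
  unfold headStartValue
  set U := supportTop p x with hUdef
  split_ifs with hc
  · have hUpos : 0 < U := by
      rcases h0 with h | h | h
      · linarith
      · linarith
      · linarith
    rcases hx.eq_or_lt with rfl | hxpos
    · have hUp : U = p := by rw [hUdef]; simp [supportTop]
      -- With no budget `[0, U - p]` collapses; `w = 0` is the point mass at zero and `h = 1` a
      -- dummy width.
      refine ⟨atomUniformStrategy (w := 0) (l := 0) (h := 1) le_rfl zero_le_one le_rfl
        zero_le_one (by simp), 0, 1 / U, le_rfl, by positivity, fun z hz => ?_, by ring⟩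
      change (atomUniform 0 0 1).real _ ≤ _
      rcases lt_or_ge (z - p) 0 with hzp | hzp
      · rw [atomUniform_real_of_neg hzp]; positivity
      · refine (atomUniform_real_le le_rfl zero_le_one le_rfl zero_lt_one _).trans ?_
        rw [zero_add, one_div_mul_eq_div, le_div_iff₀ hUpos]
        linarith
    · have hpU : 0 < U - p := by linarith
      have hw1 : (U - p) / U ≤ 1 := by rw [div_le_one hUpos]; linarith
      have hmean : (U - p) / U * (0 + (U - p) / 2) ≤ x := by
        rw [zero_add, div_mul_div_comm, div_le_iff₀ (by positivity)]
        linarith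
      -- The bound at `z - p` is `p / U + (z - p) / U = z / U`, hence the zero intercept.
      refine ⟨atomUniformStrategy (by positivity) hw1 le_rfl hpU.le hmean, 0, 1 / U, le_rfl,
        by positivity, fun z hz => ?_, by ring⟩
      change (atomUniform ((U - p) / U) 0 (U - p)).real _ ≤ _
      rcases lt_or_ge (z - p) 0 with hzp | hzp
      · rw [atomUniform_real_of_neg hzp]; positivity
      · refine (atomUniform_real_le (by positivity) hw1 le_rfl hpU _).trans_eq ?_
        rw [sub_zero, max_eq_right (by positivity)]
        field_simp
        ring
  · rw [not_le] at hc
    have hd : 0 < y - p := by linarith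
    have hw1 : x / (y - p) ≤ 1 := by rw [div_le_one hd]; linarith
    -- The intercept is nonnegative because failure of the first case, squared, gives `x * (2 * (y -
    -- p) + p) < 2 * (y - p) ^ 2`.
    have hα : 0 ≤ 1 - x / (y - p) - x / (y - p) * (p / (2 * (y - p))) := by
      have h1 : 2 * (y - p) - x > √(x * (x + 2 * p)) := by
        rw [hUdef, supportTop] at hc; linarith
      have h2 : x * (x + 2 * p) ≤ (2 * (y - p) - x) ^ 2 := by
        rw [← Real.sq_sqrt (show 0 ≤ x * (x + 2 * p) by positivity)]
        exact pow_le_pow_left₀ (Real.sqrt_nonneg _) h1.le 2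
      have h3 : 1 - x / (y - p) - x / (y - p) * (p / (2 * (y - p)))
          = (2 * (y - p) ^ 2 - 2 * x * (y - p) - x * p) / (2 * (y - p) ^ 2) := by
        field_simp
      rw [h3]
      refine div_nonneg ?_ (by positivity)
      linarith
    refine ⟨atomUniformStrategy (w := x / (y - p)) (l := 0) (h := 2 * (y - p)) (by positivity) hw1
      le_rfl (by positivity) ?_, 1 - x / (y - p) - x / (y - p) * (p / (2 * (y - p))),
      x / (y - p) / (2 * (y - p)), hα, by positivity, fun z hz => ?_, ?_⟩
    · refine le_of_eq ?_
      field_simp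
      ring
    · change (atomUniform (x / (y - p)) 0 (2 * (y - p))).real _ ≤ _
      rcases lt_or_ge (z - p) 0 with hzp | hzp
      · rw [atomUniform_real_of_neg hzp]; positivity
      · refine (atomUniform_real_le (by positivity) hw1 le_rfl (by positivity) _).trans_eq ?_
        rw [sub_zero, max_eq_right (by positivity)]
        field_simp
        ring
    · field_simp
      ring

/-- Security strategy, up to `ε`, of the player without the head start. -/
theorem exists_strategy_against_headStart {p x y ε : ℝ} (hp : 0 ≤ p) (hx : 0 ≤ x) (hy : 0 ≤ y)
    (hε : 0 < ε) :
    ∃ G : Strategy y, ∃ α β : ℝ, 0 ≤ α ∧ 0 ≤ β ∧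
      (∀ z : ℝ, 0 ≤ z → (G.1 : Measure ℝ≥0).real {t : ℝ≥0 | (t : ℝ) ≤ z + p} ≤ α + β * z) ∧
      α + β * x ≤ headStartValue p x y + ε := by
  have hU := add_le_supportTop hp hx
  have hq := supportTop_sq hp hx
  -- Bids are uniform on `[p, T]`, with the leftover mass at zero. `T = U` is optimal; `T` slightly
  -- above `p` serves `x = 0`.
  have main : ∀ T : ℝ, p < T → y ≤ (p + T) / 2 →
      ∃ G : Strategy y, ∃ α β : ℝ, 0 ≤ α ∧ 0 ≤ β ∧
      (∀ z : ℝ, 0 ≤ z → (G.1 : Measure ℝ≥0).real {t : ℝ≥0 | (t : ℝ) ≤ z + p} ≤ α + β * z) ∧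
      α + β * x = 1 - 2 * y / (p + T) * (1 - x / (T - p)) := by
    intro T hT hyT
    have hTp : 0 < T - p := by linarith
    have hpT : 0 < p + T := by linarith
    have hw1 : 2 * y / (p + T) ≤ 1 := by rw [div_le_one (by linarith)]; linarith
    refine ⟨atomUniformStrategy (w := 2 * y / (p + T)) (l := p) (h := T - p) (by positivity) hw1
      hp hTp.le ?_, 1 - 2 * y / (p + T), 2 * y / (p + T) / (T - p), by linarith, by positivity,
      fun z hz => ?_, by ring⟩
    · refine le_of_eq ?_
      field_simp
      ring
    · change (atomUniform (2 * y / (p + T)) p (T - p)).real _ ≤ _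
      refine (atomUniform_real_le (by positivity) hw1 hp hTp _).trans_eq ?_
      rw [add_sub_cancel_right, max_eq_right (by positivity)]
      ring
  unfold headStartValue
  set U := supportTop p x with hUdef
  split_ifs with hc
  · rcases hx.eq_or_lt with rfl | hxpos
    · have hUp : U = p := by rw [hUdef]; simp [supportTop]
      rw [hUp] at hc ⊢
      rcases hp.eq_or_lt with rfl | hppos
      · obtain ⟨G⟩ := (inferInstance : Nonempty (Strategy y))
        refine ⟨G, 1, 0, zero_le_one, le_rfl, fun z _ => ?_, ?_⟩
        · simp
        · simp [hε.le]
      -- Here `U = p`, and ties at `p` may be lost, so the interval is opened beyond `p`; this costs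
      -- at most `ε`.
      · obtain ⟨G, α, β, hα, hβ, hG, hv⟩ := main (p + 2 * p * ε) (by nlinarith) (by nlinarith)
        refine ⟨G, α, β, hα, hβ, hG, ?_⟩
        rw [hv]
        have h1 : 2 * y / (p + (p + 2 * p * ε)) * (1 - 0 / (p + 2 * p * ε - p))
            = y / p / (1 + ε) := by
          rw [zero_div, sub_zero, mul_one]
          field_simp
          ring
        have h2 : y / p ≤ 1 := by rw [div_le_one hppos]; linarith
        have h3 : y / p - ε ≤ y / p / (1 + ε) := by
          have h4 : 0 ≤ y / p := by positivity
          rw [le_div_iff₀ (by linarith)]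
          nlinarith
        rw [h1]
        linarith
    · obtain ⟨G, α, β, hα, hβ, hG, hv⟩ := main U (by linarith) hc
      refine ⟨G, α, β, hα, hβ, hG, ?_⟩
      have hUp : 0 < U - p := by linarith
      have hUp' : 0 < p + U := by linarith
      have hU0 : 0 < U := by linarith
      have : 2 * y / (p + U) * (1 - x / (U - p)) = y / U := by
        field_simp
        linear_combination y * hq
      rw [hv, this]
      linarith
  · rw [not_le] at hc
    have hd : 0 < y - p := by linarith
    refine ⟨atomUniformStrategy (w := 1) (l := p) (h := 2 * (y - p)) zero_le_one le_rfl hp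
      (by positivity) (by linarith), 0, 1 / (2 * (y - p)), le_rfl, by positivity,
      fun z hz => ?_, ?_⟩
    · change (atomUniform 1 p (2 * (y - p))).real _ ≤ _
      refine (atomUniform_real_le zero_le_one le_rfl hp (by positivity) _).trans_eq ?_
      rw [add_sub_cancel_right, max_eq_right (by positivity)]
      ring
    · rw [zero_add, one_div_mul_eq_div]
      linarith

/-- Here `U = 0`, so the slope `1 / U` is unavailable; `B` bids zero almost surely and the tie goes
to `A`. -/
theorem eqPayoffA_zero : eqPayoffA 0 0 0 = 1 := by
  refine le_antisymm ?_ ?_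
  · obtain ⟨G⟩ := (inferInstance : Nonempty (Strategy 0))
    exact eqPayoffA_le G fun F => payoffA_le_one 0 F G
  · obtain ⟨F⟩ := (inferInstance : Nonempty (Strategy 0))
    refine le_eqPayoffA F fun G => ?_
    have hG : ∀ᵐ y ∂(G.1 : Measure ℝ≥0), y = 0 := by
      have h1 := G.2
      simp only [ENNReal.ofReal_zero, nonpos_iff_eq_zero] at h1
      rw [lintegral_eq_zero_iff (by fun_prop)] at h1
      filter_upwards [h1] with y hy
      simpa using hy
    have h2 : ∀ᵐ z ∂(F.1 : Measure ℝ≥0).prod (G.1 : Measure ℝ≥0), z.2 = 0 :=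
      Measure.quasiMeasurePreserving_snd.ae hG
    have h3 : ((F.1 : Measure ℝ≥0).prod (G.1 : Measure ℝ≥0))
        {z : ℝ≥0 × ℝ≥0 | (z.2 : ℝ) ≤ (z.1 : ℝ) + 0} = 1 := by
      rw [← mem_ae_iff_prob_eq_one (measurableSet_win 0)]
      filter_upwards [h2] with z hz
      simp [hz]
    rw [payoffA, measureReal_def, h3, ENNReal.toReal_one]

theorem eqPayoffA_of_nonneg {p RA RB : ℝ} (hp : 0 ≤ p) (hA : 0 ≤ RA) (hB : 0 ≤ RB) :
    eqPayoffA p RA RB = headStartValue p RA RB := by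
  by_cases h0 : 0 < p ∨ 0 < RA ∨ 0 < RB
  · refine le_antisymm (le_of_forall_pos_le_add fun ε hε => ?_) ?_
    · obtain ⟨G, α, β, hα, hβ, hG, hv⟩ := exists_strategy_against_headStart hp hA hB hε
      exact eqPayoffA_le G fun F => (payoffA_le_of_affine hA hα hβ hG F).trans hv
    · obtain ⟨F, α, β, hα, hβ, hF, hv⟩ := exists_strategy_headStart hp hA h0
      refine le_eqPayoffA F fun G => le_trans (le_of_eq ?_) (le_payoffA_of_affine hB hα hβ hF G)
      linarith
  · push Not at h0
    obtain rfl : p = 0 := le_antisymm h0.1 hp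
    obtain rfl : RA = 0 := le_antisymm h0.2.1 hA
    obtain rfl : RB = 0 := le_antisymm h0.2.2 hB
    rw [eqPayoffA_zero]
    -- The formula also gives `1`, through `0 / 0 = 0`.
    simp [headStartValue, supportTop]

/-- The roles swap. The tie rule does not, but each affine bound counts ties against the player it
protects, so the same strategies work. -/
theorem eqPayoffA_of_neg {p RA RB : ℝ} (hp : p < 0) (hA : 0 ≤ RA) (hB : 0 ≤ RB) :
    eqPayoffA p RA RB = 1 - headStartValue (-p) RB RA := by
  have hp' : 0 ≤ -p := by linarith
  refine le_antisymm ?_ (le_of_forall_pos_le_add fun ε hε => ?_)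
  · obtain ⟨G, α, β, hα, hβ, hG, hv⟩ :=
      exists_strategy_headStart hp' hB (Or.inl (by linarith))
    simp only [sub_neg_eq_add] at hG
    exact eqPayoffA_le G fun F => (payoffA_le_of_affine hA hα hβ hG F).trans hv.le
  · obtain ⟨F, α, β, hα, hβ, hF, hv⟩ := exists_strategy_against_headStart hp' hB hA hε
    simp only [← sub_eq_add_neg] at hF
    have := le_eqPayoffA F fun G => le_payoffA_of_affine hB hα hβ hF G
    linarith

/-! ### Concavity of `supportTop` and its maximum under a budget. -/

section supportTop

variable {p x : ℝ}

@[simp] theorem supportTop_zero_left (hx : 0 ≤ x) : supportTop 0 x = 2 * x := by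
  rw [supportTop, mul_zero, add_zero, Real.sqrt_mul_self hx]
  ring

@[simp] theorem supportTop_zero_right : supportTop p 0 = p := by simp [supportTop]

/-- `supportTop` is concave and positively homogeneous. -/
theorem le_supportTop_combination {p₁ x₁ p₂ x₂ s t : ℝ} (hp₁ : 0 ≤ p₁) (hx₁ : 0 ≤ x₁)
    (hp₂ : 0 ≤ p₂) (hx₂ : 0 ≤ x₂) (hs : 0 ≤ s) (ht : 0 ≤ t) :
    s * supportTop p₁ x₁ + t * supportTop p₂ x₂ ≤
      supportTop (s * p₁ + t * p₂) (s * x₁ + t * x₂) := by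
  -- The root is the geometric mean of the linear forms `x` and `x + 2 * p`; this is Cauchy–Schwarz.
  have key : s * √(x₁ * (x₁ + 2 * p₁)) + t * √(x₂ * (x₂ + 2 * p₂)) ≤
      √((s * x₁ + t * x₂) * (s * x₁ + t * x₂ + 2 * (s * p₁ + t * p₂))) := by
    rw [Real.sqrt_mul hx₁, Real.sqrt_mul hx₂]
    apply Real.le_sqrt_of_sq_le
    have h1 := Real.sq_sqrt hx₁
    have h2 := Real.sq_sqrt hx₂
    have h3 := Real.sq_sqrt (show 0 ≤ x₁ + 2 * p₁ by positivity)
    have h4 := Real.sq_sqrt (show 0 ≤ x₂ + 2 * p₂ by positivity)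
    have h5 : s * x₁ + t * x₂ + 2 * (s * p₁ + t * p₂)
        = s * √(x₁ + 2 * p₁) ^ 2 + t * √(x₂ + 2 * p₂) ^ 2 := by rw [h3, h4]; ring
    have h6 : s * x₁ + t * x₂ = s * √x₁ ^ 2 + t * √x₂ ^ 2 := by rw [h1, h2]
    rw [h5, h6]
    have := mul_nonneg (mul_nonneg hs ht)
      (sq_nonneg (√x₁ * √(x₂ + 2 * p₂) - √x₂ * √(x₁ + 2 * p₁)))
    linarith
  unfold supportTop
  linarith

/-- Writing `U` for the top, `0 ≤ (p - (1 - c) * U) ^ 2 = 2 * U * (x + c * p) - c * (2 - c) * U ^ 2`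
by `supportTop_sq`; divide by `U`. -/
theorem supportTop_mul_le {M c : ℝ} (hc : c ∈ Set.Ioo (0 : ℝ) 1) (hp : 0 ≤ p) (hx : 0 ≤ x)
    (hb : x + c * p ≤ M) : supportTop p x * (c * (2 - c)) ≤ 2 * M := by
  obtain ⟨hc0, hc1⟩ := hc
  have hU := add_le_supportTop hp hx
  have hq := supportTop_sq hp hx
  rcases (show 0 ≤ supportTop p x by linarith).eq_or_lt with h | h
  · rw [← h]; nlinarith
  · refine le_of_mul_le_mul_left ?_ h
    nlinarith [sq_nonneg (p - (1 - c) * supportTop p x), mul_le_mul_of_nonneg_left hb h.le]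

/-- Equality forces the square to vanish and the budget to be exhausted, which determines `p` and
`x`. -/
theorem supportTop_mul_lt {M c : ℝ} (hM : 0 < M) (hc : c ∈ Set.Ioo (0 : ℝ) 1) (hp : 0 ≤ p)
    (hx : 0 ≤ x) (hb : x + c * p ≤ M) (hne : ¬(p = pBar M c ∧ x = M - c * pBar M c)) :
    supportTop p x * (c * (2 - c)) < 2 * M := by
  refine (supportTop_mul_le hc hp hx hb).lt_of_ne fun heq => hne ?_
  obtain ⟨hc0, hc1⟩ := hc
  have hq := supportTop_sq hp hx
  have hc2 : 0 < 2 - c := by linarith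
  have hUeq : supportTop p x = 2 * M / (c * (2 - c)) := by
    rw [eq_div_iff (by positivity)]; exact heq
  have hU : 0 < supportTop p x := by rw [hUeq]; positivity
  have hsq : (p - (1 - c) * supportTop p x) ^ 2
      = 2 * supportTop p x * (x + c * p - M) := by
    linear_combination hq - supportTop p x * heq
  have h1 : x + c * p = M := by
    refine le_antisymm hb ?_
    have h2 := sq_nonneg (p - (1 - c) * supportTop p x)
    rw [hsq] at h2
    have := nonneg_of_mul_nonneg_right h2 (by positivity)
    linarith
  rw [h1, sub_self, mul_zero] at hsq
  have h3 : p - (1 - c) * supportTop p x = 0 := by simpa using hsq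
  have h4 : p = pBar M c := by
    rw [hUeq] at h3
    unfold pBar
    rw [sub_eq_zero.1 h3]
    field_simp
  exact ⟨h4, by rw [← h4]; linarith⟩

end supportTop

/-! ### The optimal pre-allocation and its value. -/

section pBar

variable {M c : ℝ}

theorem pBar_pos (hM : 0 < M) (hc : c ∈ Set.Ioo (0 : ℝ) 1) : 0 < pBar M c := by
  obtain ⟨hc0, hc1⟩ := hc
  have h1 : 0 < 1 - c := by linarith
  have h2 : 0 < 2 - c := by linarith
  unfold pBar
  positivity

theorem sub_mul_pBar (hc : c ∈ Set.Ioo (0 : ℝ) 1) : M - c * pBar M c = M * c / (2 - c) := by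
  obtain ⟨hc0, hc1⟩ := hc
  have h2 : 0 < 2 - c := by linarith
  unfold pBar
  field_simp
  ring

theorem sub_mul_pBar_pos (hM : 0 < M) (hc : c ∈ Set.Ioo (0 : ℝ) 1) :
    0 < M - c * pBar M c := by
  rw [sub_mul_pBar hc]
  have := hc.1
  have h2 : 0 < 2 - c := by linarith [hc.2]
  positivity

theorem supportTop_pBar (hM : 0 < M) (hc : c ∈ Set.Ioo (0 : ℝ) 1) :
    supportTop (pBar M c) (M - c * pBar M c) = 2 * M / (c * (2 - c)) := by
  rw [sub_mul_pBar hc]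
  obtain ⟨hc0, hc1⟩ := hc
  have h2 : 0 < 2 - c := by linarith
  have h3 : M * c / (2 - c) * (M * c / (2 - c) + 2 * pBar M c) = M * M := by
    unfold pBar
    field_simp
    ring
  rw [supportTop, h3, Real.sqrt_mul_self hM.le]
  unfold pBar
  field_simp
  ring

theorem headStartValue_pBar {y : ℝ} (hM : 0 < M) (hc : c ∈ Set.Ioo (0 : ℝ) 1)
    (hy : c * y ≤ M) :
    headStartValue (pBar M c) (M - c * pBar M c) y = 1 - y * (c * (2 - c)) / (2 * M) := by
  have h1 : y ≤ (pBar M c + supportTop (pBar M c) (M - c * pBar M c)) / 2 := by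
    rw [supportTop_pBar hM hc]
    obtain ⟨hc0, hc1⟩ := hc
    have h2 : 0 < 2 - c := by linarith
    -- The limit of the first case at `pBar` is exactly `M / c`.
    have h3 : (pBar M c + 2 * M / (c * (2 - c))) / 2 = M / c := by
      unfold pBar
      field_simp
      ring
    rw [h3, le_div_iff₀ hc0]
    linarith
  rw [headStartValue, if_pos h1, supportTop_pBar hM hc, div_div_eq_mul_div]

end pBar

/-! ### Comparison of values across investments. -/

section headStartValue

variable {p x y : ℝ}

theorem headStartValue_of_le (h : y ≤ (p + supportTop p x) / 2) :
    headStartValue p x y = 1 - y / supportTop p x := if_pos h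

theorem headStartValue_of_lt (h : (p + supportTop p x) / 2 < y) :
    headStartValue p x y = x / (2 * (y - p)) := if_neg h.not_ge

/-- The algebraic form of the condition for the second case of `headStartValue`. -/
theorem lt_two_mul_sq_of_lt (hp : 0 ≤ p) (hx : 0 ≤ x) (h : (p + supportTop p x) / 2 < y) :
    x * (2 * (y - p) + p) < 2 * (y - p) ^ 2 ∧ x < y - p := by
  have hs := le_sqrt_supportTop hp hx
  have h1 : √(x * (x + 2 * p)) < 2 * (y - p) - x := by
    unfold supportTop at h; linarith
  refine ⟨?_, by linarith⟩
  have h2 := pow_lt_pow_left₀ h1 (Real.sqrt_nonneg _) two_ne_zero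
  rw [Real.sq_sqrt (by positivity)] at h2
  linarith

theorem headStartValue_lt {M c : ℝ} (hM : 0 < M) (hc : c ∈ Set.Ioo (0 : ℝ) 1) (hp : 0 ≤ p)
    (hx : 0 ≤ x) (hb : x + c * p ≤ M) (hy : 0 < y) (hyM : c * y < M)
    (hne : ¬(p = pBar M c ∧ x = M - c * pBar M c)) :
    headStartValue p x y < 1 - y * (c * (2 - c)) / (2 * M) := by
  have hc0 := hc.1
  have hc1 := hc.2
  have hc2 : 0 < 2 - c := by linarith
  have hU := add_le_supportTop hp hx
  rcases le_or_gt y ((p + supportTop p x) / 2) with h | h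
  · rw [headStartValue_of_le h]
    have h1 := supportTop_mul_lt hM hc hp hx hb hne
    have hU0 : 0 < supportTop p x := by linarith
    have : y * (c * (2 - c)) / (2 * M) < y / supportTop p x := by
      rw [div_lt_div_iff₀ (by positivity) hU0]
      nlinarith
    linarith
  · rw [headStartValue_of_lt h]
    obtain ⟨h1, h2⟩ := lt_two_mul_sq_of_lt hp hx h
    obtain ⟨d, rfl⟩ : ∃ d, y = p + d := ⟨y - p, by ring⟩
    rw [add_sub_cancel_left] at h1 h2 ⊢
    have hd : 0 < d := by linarith
    -- `e2` rearranges the negated claim. Its left side is positive, while `e3` (budget) and `e4`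
    -- (second case) make its right side negative.
    by_contra! hv
    set v := x / (2 * d) with hvdef
    have hx' : x = v * (2 * d) := by rw [hvdef]; field_simp
    rw [sub_le_iff_le_add, ← sub_le_iff_le_add', le_div_iff₀ (by positivity)] at hv
    have e1 : v * (2 * d + p) < d := by
      refine lt_of_mul_lt_mul_right ?_ (show (0 : ℝ) ≤ 2 * d by positivity)
      calc v * (2 * d + p) * (2 * d) = x * (2 * d + p) := by rw [hx']; ring
        _ < d * (2 * d) := by linarith
    have e2 : (2 - c) * (M - c * (p + d)) ≤ M * (2 * v - c) := by linarith
    have e3 : d * (2 - c) ≤ M := by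
      refine le_of_mul_le_mul_right ?_ (sub_pos.2 hyM)
      nlinarith [mul_le_mul_of_nonneg_left e2 hd.le]
    have e4 : 2 * M * v < d * (c * (2 - c)) := by
      refine lt_of_mul_lt_mul_right ?_ hy.le
      nlinarith [mul_le_mul_of_nonneg_left hv hd.le]
    nlinarith [mul_pos hc2 (sub_pos.2 hyM)]

theorem headStartValue_le {M c : ℝ} (hM : 0 < M) (hc : c ∈ Set.Ioo (0 : ℝ) 1) (hp : 0 ≤ p)
    (hx : 0 ≤ x) (hb : x + c * p ≤ M) (hy : 0 ≤ y) (hyM : c * y < M) :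
    headStartValue p x y ≤ 1 - y * (c * (2 - c)) / (2 * M) := by
  by_cases hne : p = pBar M c ∧ x = M - c * pBar M c
  · rw [hne.2, hne.1, headStartValue_pBar hM hc hyM.le]
  rcases hy.eq_or_lt with rfl | hy
  · have := add_le_supportTop hp hx
    rw [headStartValue_of_le (by linarith)]
    simp
  · exact (headStartValue_lt hM hc hp hx hb hy hyM hne).le

theorem headStartValue_zero_of_le (hx : 0 ≤ x) (h : y ≤ x) :
    headStartValue 0 x y = 1 - y / (2 * x) := by
  rw [headStartValue_of_le] <;> rw [supportTop_zero_left hx]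
  linarith

theorem headStartValue_zero_of_lt (hx : 0 ≤ x) (h : x < y) :
    headStartValue 0 x y = x / (2 * y) := by
  rw [headStartValue_of_lt, sub_zero]
  rw [supportTop_zero_left hx]
  linarith

/-- Without a head start the players differ only by the tie rule, which matters only when both
budgets vanish. -/
theorem headStartValue_zero_comm (hx : 0 ≤ x) (hy : 0 ≤ y) (h : x ≠ 0 ∨ y ≠ 0) :
    headStartValue 0 x y = 1 - headStartValue 0 y x := by
  rcases lt_trichotomy x y with hxy | rfl | hxy
  · rw [headStartValue_zero_of_lt hx hxy, headStartValue_zero_of_le hy hxy.le]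
    ring
  · have : x ≠ 0 := by tauto
    rw [headStartValue_zero_of_le hx le_rfl]
    field_simp
    ring
  · rw [headStartValue_zero_of_le hx hxy.le, headStartValue_zero_of_lt hy hxy]

/-- Against a real-time budget `y` that exceeds `n / c`, a player with total budget `n` gains
nothing from a head start. -/
theorem headStartValue_le_of_weak {n c : ℝ} (hc : c ∈ Set.Ioo (0 : ℝ) 1) (hp : 0 ≤ p)
    (hx : 0 ≤ x) (hb : x + c * p = n) (hn : 0 < n) (hy : n ≤ c * y) :
    headStartValue p x y ≤ n / (2 * y) := by
  have hc0 := hc.1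
  have hc1 := hc.2
  have hy0 : 0 < y := pos_of_mul_pos_right (hn.trans_le hy) hc0.le
  rcases le_or_gt y ((p + supportTop p x) / 2) with h | h
  · rw [headStartValue_of_le h]
    have h1 := supportTop_mul_le hc hp hx hb.le
    have hU : 0 < supportTop p x := by linarith [add_le_supportTop hp hx]
    set U := supportTop p x
    have h2 : (2 - c) * U ≤ 2 * y := by
      refine le_of_mul_le_mul_left ?_ hc0
      linarith
    -- Expanded: `4 * y * (U - y) ≤ c * (2 - c) * U ^ 2`, and `h1` bounds the right side by `2 * n *
    -- U`.
    have h3 : 0 ≤ (2 * y - c * U) * (2 * y - (2 - c) * U) := by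
      refine mul_nonneg ?_ (by linarith)
      nlinarith
    rw [one_sub_div hU.ne', div_le_div_iff₀ hU (by positivity)]
    nlinarith [mul_le_mul_of_nonneg_right h1 hU.le]
  · rw [headStartValue_of_lt h]
    have h2 := (lt_two_mul_sq_of_lt hp hx h).2
    rw [div_le_div_iff₀ (by linarith) (by positivity)]
    nlinarith [mul_le_mul_of_nonneg_right hy hp]

/-- If the opponent's budget net of the head start is at most `c * x`, then the opponent prefers
facing the head start over offsetting it. -/
theorem headStartValue_lt_offset {c : ℝ} (hc : c ∈ Set.Ioo (0 : ℝ) 1) (hp : 0 < p) (hx : 0 ≤ x)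
    (hy : 0 < y) (hyc : y - c * p ≤ c * x) :
    headStartValue p x y < 1 - (y - c * p) / (2 * x) := by
  have hc0 := hc.1
  have hc1 := hc.2
  rcases hx.eq_or_lt with rfl | hx0
  -- At `x = 0` the right side of the claim is `1`, by division by zero.
  · rw [headStartValue_of_le, supportTop_zero_right, mul_zero, div_zero]
    · have : 0 < y / p := by positivity
      linarith
    · rw [supportTop_zero_right]
      nlinarith
  rcases le_or_gt y ((p + supportTop p x) / 2) with h | h
  · rw [headStartValue_of_le h]
    have hU : 0 < supportTop p x := by linarith [add_le_supportTop hp.le hx]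
    have hU2 : supportTop p x < 2 * (x + p) := by
      have : √(x * (x + 2 * p)) < x + p := by
        rw [Real.sqrt_lt' (by linarith)]
        nlinarith [sq_pos_of_pos hp]
      unfold supportTop
      linarith
    have : (y - c * p) / (2 * x) < y / supportTop p x := by
      rw [div_lt_div_iff₀ (by positivity) hU]
      rcases le_or_gt (y - c * p) 0 with h0 | h0
      · nlinarith [mul_pos hy hx0]
      · nlinarith [mul_lt_mul_of_pos_left hU2 h0]
    linarith
  · rw [headStartValue_of_lt h]
    have h2 := (lt_two_mul_sq_of_lt hp.le hx h).2
    have h3 : x / (2 * (y - p)) < 1 / 2 := by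
      rw [div_lt_div_iff₀ (by linarith) two_pos]
      linarith
    have h4 : (y - c * p) / (2 * x) ≤ 1 / 2 := by
      rw [div_le_div_iff₀ (by positivity) two_pos]
      nlinarith
    linarith

end headStartValue

/-! ### Partial reduction of a head start is dominated. -/

section response

/-- A ratio of an affine and a positive concave quantity is quasi-convex. -/
theorem ratio_lt_of_combination {n₀ n₁ u₀ u₁ n u s t r : ℝ} (hs : 0 ≤ s) (ht : 0 < t)
    (hu : 0 < u) (hn : n = s * n₀ + t * n₁) (hu' : s * u₀ + t * u₁ ≤ u) (hr : 0 ≤ r)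
    (h₀ : n₀ ≤ r * u₀) (h₁ : n₁ < r * u₁) : n / u < r := by
  rw [div_lt_iff₀ hu, hn]
  nlinarith [mul_le_mul_of_nonneg_left h₀ hs, mul_lt_mul_of_pos_left h₁ ht,
    mul_le_mul_of_nonneg_left hu' hr]

theorem supportTop_sub_le {p a x : ℝ} (hpa : p ≤ a) (hx : 0 ≤ x) :
    supportTop p x + (a - p) ≤ supportTop a x := by
  have : √(x * (x + 2 * p)) ≤ √(x * (x + 2 * a)) := by
    apply Real.sqrt_le_sqrt
    gcongr
  unfold supportTop
  linarith

theorem continuous_supportTop_comp {f g : ℝ → ℝ} (hf : Continuous f) (hg : Continuous g) :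
    Continuous fun t => supportTop (f t) (g t) := by
  unfold supportTop
  fun_prop

/-- At the boundary between the two cases of `headStartValue` they agree. -/
theorem headStartValue_boundary {p x y : ℝ} (hp : 0 ≤ p) (hx : 0 ≤ x) (hy : 0 < y)
    (h : y = (p + supportTop p x) / 2) :
    1 - y / supportTop p x = x / (2 * (y - p)) := by
  have hU := add_le_supportTop hp hx
  have hq := supportTop_sq hp hx
  have hU0 : 0 < supportTop p x := by linarith
  set U := supportTop p x with hUdef
  rcases hx.eq_or_lt with rfl | hx0
  · have : U = p := by rw [hUdef]; simp
    have hyU : y = U := by linarith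
    rw [hyU, div_self hU0.ne']
    simp
  · have : 0 < U - p := by linarith
    have h2 : 2 * (y - p) = U - p := by linarith
    rw [h2, h, eq_div_iff this.ne']
    field_simp
    linear_combination hq

variable {x n k : ℝ}

/-- Reducing the head start `a` to `p`, at unit cost `k`, is dominated either by not reducing it
or by eliminating it. -/
theorem headStartValue_response {p a : ℝ} (hx0 : 0 < x) (hk : k ∈ Set.Ioo (0 : ℝ) 1) (hp : 0 ≤ p)
    (hpa : p < a) (hn : 0 ≤ n + k * p) :
    headStartValue a x (n + k * a) < headStartValue p x (n + k * p) ∨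
      0 ≤ n ∧ headStartValue 0 x n ≤ headStartValue p x (n + k * p) := by
  have hk0 := hk.1
  have hk1 := hk.2
  have hx := hx0.le
  have ha : 0 < a := by linarith
  have hUp := add_le_supportTop hp hx
  have hUa := add_le_supportTop ha.le hx
  have hUpa := supportTop_sub_le hpa.le hx
  rcases le_or_gt (n + k * p) ((p + supportTop p x) / 2) with h | h
  swap
  -- In the second case the value is `x / (2 * (n - (1 - k) * p))`, and removing the rest of the
  -- head start lowers it.
  · right
    have h1 := (lt_two_mul_sq_of_lt hp hx h).2
    have h2 : 0 ≤ (1 - k) * p := mul_nonneg (by linarith) hp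
    rw [headStartValue_of_lt h, headStartValue_zero_of_lt hx (by linarith)]
    refine ⟨by linarith, ?_⟩
    exact div_le_div_of_nonneg_left hx (by linarith) (by linarith)
  -- The right side grows with slope at least `1 > k` in the head start, so the first case persists
  -- up to `a`.
  have hna : n + k * a ≤ (a + supportTop a x) / 2 := by nlinarith
  rcases lt_or_ge n 0 with hn0 | hn0
  · left
    have hp0 : 0 < p := by nlinarith
    rw [headStartValue_of_le h, headStartValue_of_le hna]
    have hcomb : p * supportTop a x ≤ a * supportTop p x := by
      have := le_supportTop_combination (p₁ := 0) (x₁ := x) (p₂ := a) (x₂ := x) le_rfl hx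
        ha.le hx (s := 1 - p / a) (t := p / a)
        (by rw [sub_nonneg, div_le_one ha]; exact hpa.le) (by positivity)
      rw [supportTop_zero_left hx, mul_zero, zero_add, div_mul_cancel₀ _ ha.ne',
        ← add_mul, sub_add_cancel, one_mul] at this
      have h3 : 0 ≤ (1 - p / a) * (2 * x) :=
        mul_nonneg (by rw [sub_nonneg, div_le_one ha]; exact hpa.le) (by positivity)
      have h4 : p / a * supportTop a x ≤ supportTop p x := by linarith
      rw [div_mul_eq_mul_div, div_le_iff₀ ha] at h4
      linarith
    have : (n + k * p) / supportTop p x < (n + k * a) / supportTop a x := by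
      rw [div_lt_div_iff₀ (by linarith) (by linarith)]
      refine lt_of_mul_lt_mul_left ?_ hp
      have e1 : n * a < n * p := mul_lt_mul_of_neg_left hpa hn0
      have e2 := mul_le_mul_of_nonneg_left hcomb hn
      have e3 : 0 < supportTop p x := by linarith
      nlinarith
    linarith
  by_contra! hcon
  obtain ⟨hA, h0⟩ := hcon
  replace h0 := h0 hn0
  rw [headStartValue_of_le h, headStartValue_of_le hna] at hA
  -- the smallest head start at which the first case applies
  obtain ⟨p₀, hp₀, hp₀p, hle, hval⟩ : ∃ p₀, 0 ≤ p₀ ∧ p₀ ≤ p ∧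
      n + k * p₀ ≤ (p₀ + supportTop p₀ x) / 2 ∧
      headStartValue 0 x n ≤ 1 - (n + k * p₀) / supportTop p₀ x := by
    rcases le_or_gt n x with hnx | hnx
    · refine ⟨0, le_rfl, hp, ?_, ?_⟩
      · rw [supportTop_zero_left hx]; linarith
      · rw [headStartValue_zero_of_le hx hnx, supportTop_zero_left hx, mul_zero, add_zero]
    · have hcont : ContinuousOn (fun t => (t + supportTop t x) / 2 - (n + k * t))
          (Set.Icc 0 p) := by
        have := continuous_supportTop_comp continuous_id (continuous_const (y := x))
        simp only [id] at this
        exact Continuous.continuousOn (by fun_prop)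
      obtain ⟨p₀, ⟨hp₀, hp₀p⟩, hroot⟩ := intermediate_value_Icc hp hcont
        (show (0 : ℝ) ∈ Set.Icc _ _ from ⟨by
          simp only [supportTop_zero_left hx]; linarith, by linarith⟩)
      simp only at hroot
      refine ⟨p₀, hp₀, hp₀p, by linarith, ?_⟩
      have hn1 : 0 < n := by linarith
      rw [headStartValue_boundary hp₀ hx (by positivity) (by linarith),
        headStartValue_zero_of_lt hx hnx]
      have h1 := add_le_supportTop hp₀ hx
      have h2 : 0 ≤ (1 - k) * p₀ := mul_nonneg (by linarith) hp₀
      exact div_le_div_of_nonneg_left hx (by linarith) (by linarith)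
  have h1 : headStartValue p x (n + k * p) < 1 - (n + k * p₀) / supportTop p₀ x :=
    h0.trans_le hval
  rw [headStartValue_of_le h] at h1
  have hU₀ := add_le_supportTop hp₀ hx
  have hU₀pos : 0 < supportTop p₀ x := by linarith
  have hp₀a : p₀ < a := by linarith
  have hpp : p₀ < p := by
    refine lt_of_le_of_ne hp₀p fun he => ?_
    rw [he] at h1
    exact lt_irrefl _ h1
  -- The ratio budget over top at `p` is at least that at `a` and exceeds that at `p₀`, against
  -- quasi-convexity.
  obtain ⟨s, t, hs, ht, hst, hcp⟩ : p ∈ openSegment ℝ p₀ a := by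
    rw [openSegment_eq_Ioo hp₀a]
    exact ⟨hpp, hpa⟩
  rw [smul_eq_mul, smul_eq_mul] at hcp
  have hcomb := le_supportTop_combination hp₀ hx ha.le hx hs.le ht.le
  rw [hcp, ← add_mul, hst, one_mul] at hcomb
  have hr : 0 ≤ (n + k * p) / supportTop p x := div_nonneg hn (by linarith)
  refine lt_irrefl _ (ratio_lt_of_combination (n₀ := n + k * a) (n₁ := n + k * p₀)
    (u₀ := supportTop a x) (u₁ := supportTop p₀ x) ht.le hs (by linarith)
    ?_ ?_ hr ?_ ?_ : (n + k * p) / supportTop p x < (n + k * p) / supportTop p x)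
  · rw [← hcp]
    linear_combination -n * hst
  · linarith
  · rw [← div_le_iff₀ (by linarith)]
    linarith
  · rw [← div_lt_iff₀ hU₀pos]
    linarith

end response

/-! ### Monotonicity along `A`'s budget line. -/

section investment

variable {M c m : ℝ}

/-- If the first case of `headStartValue` applies to an investment, it applies to any larger one. -/
theorem le_add_supportTop_of_le {a b : ℝ} (hc : 0 < c) (ha : 0 ≤ a) (hab : a ≤ b)
    (hb : c * b ≤ M) (hm : c * m ≤ M) (h : m ≤ (a + supportTop a (M - c * a)) / 2) :
    m ≤ (b + supportTop b (M - c * b)) / 2 := by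
  have hT : b ≤ M / c := by rw [le_div_iff₀ hc]; linarith
  obtain ⟨s, t, hs, ht, hst, hcp⟩ : b ∈ segment ℝ a (M / c) := by
    rw [segment_eq_Icc (hab.trans hT)]
    exact ⟨hab, hT⟩
  rw [smul_eq_mul, smul_eq_mul] at hcp
  have hca : c * a ≤ c * b := by gcongr
  -- At the end `M / c` of the budget line the first-case bound equals `M / c ≥ m`, so concavity
  -- keeps it above `m` on `[a, M / c]`.
  have h1 := le_supportTop_combination (x₁ := M - c * a) (p₂ := M / c) (x₂ := 0) ha (by linarith)
    (by linarith) le_rfl hs ht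
  have h2 : s * (M - c * a) + t * 0 = M - c * b := by
    rw [← hcp]
    field_simp
    linear_combination M * hst
  rw [hcp, h2, supportTop_zero_right] at h1
  have h3 : m ≤ M / c := by rw [le_div_iff₀ hc]; linarith
  have h4 := mul_le_mul_of_nonneg_left h hs
  have h5 := mul_le_mul_of_nonneg_left h3 ht
  have h6 : m = s * m + t * m := by rw [← add_mul, hst, one_mul]
  linarith

/-- The first case holds from `pBar` on, and there the top is concave along the budget line with its
strict maximum at `pBar`, hence strictly decreasing. -/
theorem headStartValue_lt_of_pBar_le {a b : ℝ} (hM : 0 < M) (hc : c ∈ Set.Ioo (0 : ℝ) 1)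
    (hm : 0 < m) (hmM : c * m ≤ M) (ha : pBar M c ≤ a) (hab : a < b) (hb : c * b ≤ M) :
    headStartValue b (M - c * b) m < headStartValue a (M - c * a) m := by
  have hp := pBar_pos hM hc
  have hc0 := hc.1
  have hc2 : 0 < 2 - c := by linarith [hc.2]
  have hca : c * a ≤ c * b := by gcongr
  have hcase : m ≤ (pBar M c + supportTop (pBar M c) (M - c * pBar M c)) / 2 := by
    rw [supportTop_pBar hM hc]
    have h3 : (pBar M c + 2 * M / (c * (2 - c))) / 2 = M / c := by
      unfold pBar
      field_simp
      ring
    rw [h3, le_div_iff₀ hc0]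
    linarith
  have hcasea := le_add_supportTop_of_le hc0 hp.le ha (by linarith) hmM hcase
  have hcaseb := le_add_supportTop_of_le hc0 (hp.le.trans ha) hab.le hb hmM hcasea
  rw [headStartValue_of_le hcasea, headStartValue_of_le hcaseb]
  have hb0 : 0 < b := by linarith
  have hUb0 : 0 < supportTop b (M - c * b) := by
    linarith [add_le_supportTop hb0.le (sub_nonneg.2 hb)]
  have hlt : supportTop b (M - c * b) < supportTop (pBar M c) (M - c * pBar M c) := by
    rw [supportTop_pBar hM hc, lt_div_iff₀ (by positivity)]
    exact supportTop_mul_lt hM hc hb0.le (sub_nonneg.2 hb) (by linarith)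
      fun h => by linarith [h.1]
  obtain ⟨s, t, hs, ht, hst, hcp⟩ : a ∈ segment ℝ (pBar M c) b := by
    rw [segment_eq_Icc (ha.trans hab.le)]
    exact ⟨ha, hab.le⟩
  rw [smul_eq_mul, smul_eq_mul] at hcp
  have hs0 : 0 < s := by
    refine lt_of_le_of_ne hs fun h => ?_
    rw [← h] at hst hcp
    rw [zero_add] at hst
    rw [hst, zero_mul, zero_add, one_mul] at hcp
    exact hab.ne hcp.symm
  have h1 := le_supportTop_combination hp.le (sub_mul_pBar_pos hM hc).le hb0.le
    (sub_nonneg.2 hb) hs ht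
  have h2 : s * (M - c * pBar M c) + t * (M - c * b) = M - c * a := by
    rw [← hcp]
    linear_combination M * hst
  rw [hcp, h2] at h1
  have h3 := mul_lt_mul_of_pos_left hlt hs0
  have h4 : supportTop b (M - c * b)
      = s * supportTop b (M - c * b) + t * supportTop b (M - c * b) := by
    rw [← add_mul, hst, one_mul]
  have h5 : supportTop b (M - c * b) < supportTop a (M - c * a) := by linarith
  have := div_lt_div_of_pos_left hm hUb0 h5
  linarith

theorem one_div_le_of_combination {s t u v w : ℝ} (hs : 0 ≤ s) (ht : 0 ≤ t) (hst : s + t = 1)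
    (hu : 0 < u) (hv : 0 < v) (h : s * u + t * v ≤ w) : 1 / w ≤ s * (1 / u) + t * (1 / v) := by
  have hconv := convexOn_zpow (𝕜 := ℝ) (-1)
  have h1 := hconv.2 (Set.mem_Ioi.2 hu) (Set.mem_Ioi.2 hv) hs ht hst
  simp only [smul_eq_mul, zpow_neg_one] at h1
  have h2 : 0 < s * u + t * v := (hconv.1 (Set.mem_Ioi.2 hu) (Set.mem_Ioi.2 hv) hs ht hst)
  rw [one_div, one_div, one_div]
  exact (inv_anti₀ h2 h).trans h1

end investment

/-! ### The offsetting response and the single crossing. -/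

/-- The payoff of `A` after the pre-allocation `a` when `B` responds with `pHat`. -/
def offsetValue (M c m k a : ℝ) : ℝ := (M - c * a) * (k * (2 - k)) / (2 * (m - k * a))

section offsetValue

variable {M c m k : ℝ}

theorem offsetValue_lt_iff {a b : ℝ} (hk : k ∈ Set.Ioo (0 : ℝ) 1) (ha : k * a < m)
    (hb : k * b < m) : offsetValue M c m k a < offsetValue M c m k b ↔
      0 < (b - a) * (k * M - c * m) := by
  have hk2 : 0 < k * (2 - k) := mul_pos hk.1 (by linarith [hk.2])
  unfold offsetValue
  rw [div_lt_div_iff₀ (by linarith) (by linarith), ← sub_pos]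
  have : (M - c * b) * (k * (2 - k)) * (2 * (m - k * a)) -
      (M - c * a) * (k * (2 - k)) * (2 * (m - k * b))
      = 2 * (k * (2 - k)) * ((b - a) * (k * M - c * m)) := by ring
  rw [this]
  exact mul_pos_iff_of_pos_left (by positivity)

theorem offsetValue_le_iff {a b : ℝ} (hk : k ∈ Set.Ioo (0 : ℝ) 1) (ha : k * a < m)
    (hb : k * b < m) : offsetValue M c m k a ≤ offsetValue M c m k b ↔
      (a - b) * (k * M - c * m) ≤ 0 := by
  rw [← not_lt, offsetValue_lt_iff hk hb ha, not_lt]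

/-- `offsetValue` is convex in the pre-allocation if `m / k ≤ M / c`. -/
theorem offsetValue_combination_le {a b s t : ℝ} (hk : k ∈ Set.Ioo (0 : ℝ) 1)
    (hcm : c * m ≤ k * M) (ha : k * a < m) (hb : k * b < m) (hs : 0 ≤ s) (ht : 0 ≤ t)
    (hst : s + t = 1) :
    offsetValue M c m k (s * a + t * b) ≤
      s * offsetValue M c m k a + t * offsetValue M c m k b := by
  have hk0 := hk.1
  have hk2 : 0 < 2 - k := by linarith [hk.2]
  have heq : ∀ z, k * z < m → offsetValue M c m k z
      = (2 - k) / 2 * (c + (k * M - c * m) * (1 / (m - k * z))) := by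
    intro z hz
    have hz' : m - k * z ≠ 0 := by linarith
    have e : (M - c * z) * (k * (2 - k)) = (2 - k) * (c * (m - k * z) + (k * M - c * m)) := by
      ring
    rw [offsetValue, e]
    generalize m - k * z = D at hz' ⊢
    field_simp
  have hm : m = s * m + t * m := by rw [← add_mul, hst, one_mul]
  have hab : k * (s * a + t * b) < m := by
    rcases hs.eq_or_lt with rfl | hs0
    · rw [zero_add] at hst
      simpa [hst] using hb
    · have h1 := mul_lt_mul_of_pos_left ha hs0
      have h2 := mul_le_mul_of_nonneg_left hb.le ht
      linarith
  rw [heq _ ha, heq _ hb, heq _ hab]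
  have h1 := one_div_le_of_combination (w := m - k * (s * a + t * b)) hs ht hst (sub_pos.2 ha)
    (sub_pos.2 hb) (by linarith)
  have h2 := mul_le_mul_of_nonneg_left h1 (sub_nonneg.2 hcm)
  have h3 : (2 - k) / 2 * c = s * ((2 - k) / 2 * c) + t * ((2 - k) / 2 * c) := by
    rw [← add_mul, hst, one_mul]
  have h4 := mul_le_mul_of_nonneg_left h2 (show 0 ≤ (2 - k) / 2 by linarith)
  linarith

/-- The right side is the second-case value, so there `B` strictly prefers `pHat`. Cross-multiplied,
the gap is a positive multiple of `(1 - k) ^ 2 * m + k * (1 - k) * a`. -/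
theorem offsetValue_lt_of_lt {a : ℝ} (hk : k ∈ Set.Ioo (0 : ℝ) 1) (hm : 0 < m) (ha : 0 ≤ a)
    (hx : 0 < M - c * a) (hma : k * a < m) (hd : 0 < m - a) :
    offsetValue M c m k a < (M - c * a) / (2 * (m - a)) := by
  have hk0 := hk.1
  have hk1 := hk.2
  unfold offsetValue
  rw [div_lt_div_iff₀ (by linarith) (by linarith)]
  have h1 : 0 < (1 - k) ^ 2 * m + k * (1 - k) * a := by
    have : 0 < 1 - k := by linarith
    positivity
  have h2 := mul_pos hx h1
  linarith

/-- Somewhere below any pre-allocation in the first case of `headStartValue` there is one at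
which `B` strictly prefers `pHat`. -/
theorem exists_offsetValue_lt {x : ℝ} (hM : 0 < M) (hm : 0 < m) (hc : c ∈ Set.Ioo (0 : ℝ) 1)
    (hk : k ∈ Set.Ioo (0 : ℝ) 1) (hkM : k * M < m) (hx : 0 ≤ x)
    (hxM : c * x < M) (hcase : m ≤ (x + supportTop x (M - c * x)) / 2) :
    ∃ x₀, 0 ≤ x₀ ∧ x₀ ≤ x ∧ m ≤ (x₀ + supportTop x₀ (M - c * x₀)) / 2 ∧
      offsetValue M c m k x₀ < 1 - m / supportTop x₀ (M - c * x₀) := by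
  have hc0 := hc.1
  have hk0 := hk.1
  have hk1 := hk.2
  rcases le_or_gt m M with hmM | hmM
  · refine ⟨0, le_rfl, hx, ?_, ?_⟩
    · simp only [mul_zero, sub_zero, supportTop_zero_left hM.le]
      linarith
    · simp only [offsetValue, mul_zero, sub_zero, supportTop_zero_left hM.le]
      rw [one_sub_div (by positivity), div_lt_div_iff₀ (by positivity) (by positivity)]
      have h1 : 0 < (m - k * M) * ((2 - k) * M - m) := by
        refine mul_pos (by linarith) ?_
        nlinarith
      nlinarith
  · have hcont : ContinuousOn (fun t => (t + supportTop t (M - c * t)) / 2) (Set.Icc 0 x) := by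
      have := continuous_supportTop_comp continuous_id
        (by fun_prop : Continuous fun t : ℝ => M - c * t)
      simp only [id] at this
      exact Continuous.continuousOn (by fun_prop)
    obtain ⟨x₀, ⟨hx₀, hx₀x⟩, hroot⟩ := intermediate_value_Icc hx hcont
      (show m ∈ Set.Icc _ _ from ⟨by
        simp only [mul_zero, sub_zero, supportTop_zero_left hM.le]; linarith, hcase⟩)
    simp only at hroot
    have hcx : c * x₀ ≤ c * x := by gcongr
    have hR : 0 < M - c * x₀ := by linarith
    refine ⟨x₀, hx₀, hx₀x, hroot.ge, ?_⟩
    rw [headStartValue_boundary hx₀ hR.le hm hroot.symm]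
    have h1 := add_le_supportTop hx₀ hR.le
    have hd : 0 < m - x₀ := by linarith
    refine offsetValue_lt_of_lt hk hm hx₀ hR ?_ hd
    nlinarith

/-- As `A`'s pre-allocation grows, `B`'s preference switches at most once from `pHat` to `0`. -/
theorem headStartValue_lt_offsetValue_of_lt {x y : ℝ} (hM : 0 < M) (hm : 0 < m)
    (hc : c ∈ Set.Ioo (0 : ℝ) 1) (hk : k ∈ Set.Ioo (0 : ℝ) 1) (hkM : k * M < m)
    (hcm : c * m ≤ k * M) (hx : 0 ≤ x) (hxy : x < y) (hyM : c * y ≤ M) (hym : k * y < m)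
    (h : headStartValue x (M - c * x) m ≤ offsetValue M c m k x) :
    headStartValue y (M - c * y) m < offsetValue M c m k y := by
  have hc0 := hc.1
  have hk0 := hk.1
  have hk1 := hk.2
  have hcxy : c * x < c * y := by gcongr
  have hkxy : k * x < k * y := by gcongr
  have hy : 0 < y := by linarith
  have hR : 0 < M - c * x := by linarith
  have hcmM : c * m ≤ M := by nlinarith
  have hcase : m ≤ (x + supportTop x (M - c * x)) / 2 := by
    by_contra! hlt
    rw [headStartValue_of_lt hlt] at h
    have h1 := add_le_supportTop hx hR.le
    exact absurd h (offsetValue_lt_of_lt hk hm hx hR (by linarith) (by linarith)).not_ge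
  have hcasey := le_add_supportTop_of_le hc0 hx hxy.le hyM hcmM hcase
  obtain ⟨x₀, hx₀, hx₀x, hcase₀, hlt₀⟩ :=
    exists_offsetValue_lt hM hm hc hk hkM hx (by linarith) hcase
  rw [headStartValue_of_le hcase] at h
  rw [headStartValue_of_le hcasey]
  -- In the first case `1 - m / U` minus the convex `offsetValue` is concave; it is positive at `x₀`
  -- and nonpositive at `x`, so it cannot be nonnegative at `y`.
  by_contra! hcon
  have hne : x₀ < x := by
    refine lt_of_le_of_ne hx₀x fun he => ?_
    rw [he] at hlt₀
    exact absurd h hlt₀.not_ge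
  obtain ⟨s, t, hs, ht, hst, hcp⟩ : x ∈ openSegment ℝ x₀ y := by
    rw [openSegment_eq_Ioo (hne.trans hxy)]
    exact ⟨hne, hxy⟩
  rw [smul_eq_mul, smul_eq_mul] at hcp
  have hcx₀ : c * x₀ ≤ c * x := by gcongr
  have hkx₀ : k * x₀ ≤ k * x := by gcongr
  have hU₀ := add_le_supportTop hx₀ (show 0 ≤ M - c * x₀ by linarith)
  have hUy := add_le_supportTop hy.le (sub_nonneg.2 hyM)
  have h1 := le_supportTop_combination hx₀ (show 0 ≤ M - c * x₀ by linarith) hy.le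
    (sub_nonneg.2 hyM) hs.le ht.le
  have h2 : s * (M - c * x₀) + t * (M - c * y) = M - c * x := by
    rw [← hcp]
    linear_combination M * hst
  rw [hcp, h2] at h1
  have h3 := mul_le_mul_of_nonneg_left (one_div_le_of_combination hs.le ht.le hst
    (by linarith) (by linarith) h1) hm.le
  have h4 := offsetValue_combination_le hk hcm (show k * x₀ < m by linarith) hym hs.le ht.le hst
  rw [hcp] at h4
  have h5 := mul_lt_mul_of_pos_left hlt₀ hs
  have h6 := mul_le_mul_of_nonneg_left hcon ht.le
  rw [div_eq_mul_one_div] at h h5 h6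
  linarith

/-- Existence of the switching point, strictly between `0` and the pre-allocation `e` after which
`B`'s budget no longer suffices for offsetting. -/
theorem exists_headStartValue_eq_offsetValue (hM : 0 < M) (hm : 0 < m)
    (hc : c ∈ Set.Ioo (0 : ℝ) 1) (hk : k ∈ Set.Ioo (0 : ℝ) 1) (hkM : k * M < m)
    (hcm : c * m < k * M) :
    ∃ a, 0 < a ∧ c * a < M ∧ k * (M - c * a) < m - k * a ∧
      headStartValue a (M - c * a) m = offsetValue M c m k a := by
  have hc0 := hc.1
  have hc1 := hc.2
  have hk0 := hk.1
  have hk1 := hk.2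
  have hc2 : 0 < 1 - c := by linarith
  -- `e` solves `m - k * e = k * (M - c * e)`, the limit of `B`'s ability to offset.
  obtain ⟨e, he⟩ : ∃ e, e = (m - k * M) / (k * (1 - c)) := ⟨_, rfl⟩
  have he1 : k * (1 - c) * e = m - k * M := by
    rw [he]
    field_simp
  have he0 : 0 < e := by
    rw [he]
    exact div_pos (by linarith) (by positivity)
  have heM : c * e < M := by
    have : k * (1 - c) * (c * e) < k * (1 - c) * M := by
      calc k * (1 - c) * (c * e) = c * (m - k * M) := by rw [← he1]; ring
        _ < _ := by linarith
    exact lt_of_mul_lt_mul_left this (by positivity)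
  have hR : 0 < M - c * e := by linarith
  have hes := le_sqrt_supportTop he0.le hR.le
  have hcase : m ≤ (e + supportTop e (M - c * e)) / 2 := by
    have h1 : m = k * (e + (M - c * e)) := by linarith
    have h2 : k * (e + (M - c * e)) ≤ 1 * (e + (M - c * e)) := by gcongr
    unfold supportTop
    linarith
  have hlt : headStartValue e (M - c * e) m < offsetValue M c m k e := by
    refine (headStartValue_lt_offset hk he0 hR.le hm (by linarith)).trans_eq ?_
    have h1 : m - k * e = k * (M - c * e) := by linarith
    unfold offsetValue
    rw [h1]
    field_simp
  obtain ⟨x₀, hx₀, hx₀e, hcase₀, hlt₀⟩ :=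
    exists_offsetValue_lt hM hm hc hk hkM he0.le heM hcase
  have hpos : ∀ t ∈ Set.Icc x₀ e, 0 < supportTop t (M - c * t) ∧ 0 < m - k * t := by
    intro t ht
    have ht0 : 0 ≤ t := hx₀.trans ht.1
    have h1 : c * t ≤ c * e := by gcongr; exact ht.2
    have h2 : k * t ≤ k * e := by gcongr; exact ht.2
    have h3 := add_le_supportTop ht0 (show 0 ≤ M - c * t by linarith)
    exact ⟨by linarith, by nlinarith⟩
  have hcont : ContinuousOn (fun t => offsetValue M c m k t - (1 - m / supportTop t (M - c * t)))
      (Set.Icc x₀ e) := by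
    have h1 := continuous_supportTop_comp continuous_id
      (by fun_prop : Continuous fun t : ℝ => M - c * t)
    simp only [id] at h1
    unfold offsetValue
    refine ContinuousOn.sub (ContinuousOn.div (by fun_prop) (by fun_prop) fun t ht => ?_)
      (ContinuousOn.sub (by fun_prop) (ContinuousOn.div (by fun_prop) h1.continuousOn
        fun t ht => ?_))
    · have := (hpos t ht).2
      positivity
    · exact (hpos t ht).1.ne'
  rw [headStartValue_of_le hcase] at hlt
  obtain ⟨a, ⟨ha0, hae⟩, hroot⟩ := intermediate_value_Icc hx₀e hcont
    (show (0 : ℝ) ∈ Set.Icc _ _ from ⟨by linarith, by linarith⟩)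
  simp only [sub_eq_zero] at hroot
  have hxa : x₀ < a := by
    refine lt_of_le_of_ne ha0 fun h => ?_
    rw [h] at hlt₀
    exact hlt₀.ne hroot
  have hae' : a < e := by
    refine lt_of_le_of_ne hae fun h => ?_
    rw [← h] at hlt
    exact hlt.ne hroot.symm
  have hca : c * a < c * e := by gcongr
  have hcasea := le_add_supportTop_of_le hc0 hx₀ hxa.le (by linarith) (by nlinarith) hcase₀
  refine ⟨a, by linarith, by linarith, ?_, ?_⟩
  · have : k * (1 - c) * a < k * (1 - c) * e := by gcongr
    linarith
  · rw [headStartValue_of_le hcasea, hroot]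

end offsetValue

/-! ### Best responses of `B`. -/

section stackelberg

variable {MA cA MB cB : ℝ}

theorem uA_of_le {a b : ℝ} (ha : cA * a ≤ MA) (hb : cB * b ≤ MB) (hba : b ≤ a) :
    uA MA cA MB cB a b = headStartValue (a - b) (MA - cA * a) (MB - cB * b) :=
  eqPayoffA_of_nonneg (sub_nonneg.2 hba) (sub_nonneg.2 ha) (sub_nonneg.2 hb)

theorem uA_zero_right {a : ℝ} (ha0 : 0 ≤ a) (ha : cA * a ≤ MA) (hMB : 0 ≤ MB) :
    uA MA cA MB cB a 0 = headStartValue a (MA - cA * a) MB := by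
  rw [uA_of_le ha (by simpa) ha0]
  simp

theorem uA_of_lt {a b : ℝ} (ha : cA * a ≤ MA) (hb : cB * b ≤ MB) (hab : a < b) :
    uA MA cA MB cB a b = 1 - headStartValue (b - a) (MB - cB * b) (MA - cA * a) := by
  rw [uA, eqPayoffA_of_neg (sub_neg.2 hab) (sub_nonneg.2 ha) (sub_nonneg.2 hb), neg_sub]

theorem uA_nonneg (a b : ℝ) : 0 ≤ uA MA cA MB cB a b :=
  Real.iSup_nonneg fun FA => Real.iInf_nonneg fun FB => payoffA_nonneg _ FA FB

/-- After paying `cB * a` to neutralize `a`, `B` faces the investment problem with budget `MB - cB *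
a`. -/
theorem pHat_eq (hcB : cB ∈ Set.Ioo (0 : ℝ) 1) (a : ℝ) :
    pHat MB cB a = a + pBar (MB - cB * a) cB := by
  obtain ⟨h0, h1⟩ := hcB
  have h2 : 2 - cB ≠ 0 := by linarith
  unfold pHat pBar
  field_simp
  ring

theorem mul_pHat_le (hcB : cB ∈ Set.Ioo (0 : ℝ) 1) {a : ℝ} (ha : cB * a ≤ MB) :
    cB * pHat MB cB a ≤ MB := by
  have h2 : 0 < 2 - cB := by linarith [hcB.2]
  have h0 := hcB.1
  have : 0 ≤ cB * ((MB - cB * a) / (2 - cB)) :=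
    mul_nonneg h0.le (div_nonneg (sub_nonneg.2 ha) h2.le)
  have h3 : cB * (MB / cB) = MB := by field_simp
  unfold pHat
  rw [mul_sub, h3]
  linarith

theorem lt_pHat (hcB : cB ∈ Set.Ioo (0 : ℝ) 1) {a : ℝ} (ha : cB * a < MB) :
    a < pHat MB cB a := by
  rw [pHat_eq hcB]
  linarith [pBar_pos (sub_pos.2 ha) hcB]

theorem uA_pHat (hcB : cB ∈ Set.Ioo (0 : ℝ) 1) {a : ℝ} (ha : cA * a ≤ MA) (hab : cB * a < MB)
    (h : cB * (MA - cA * a) ≤ MB - cB * a) :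
    uA MA cA MB cB a (pHat MB cB a) = offsetValue MA cA MB cB a := by
  rw [uA_of_lt ha (mul_pHat_le hcB hab.le) (lt_pHat hcB hab), pHat_eq hcB, add_sub_cancel_left]
  have h1 : MB - cB * (a + pBar (MB - cB * a) cB)
      = MB - cB * a - cB * pBar (MB - cB * a) cB := by ring
  rw [h1, headStartValue_pBar (sub_pos.2 hab) hcB h, offsetValue]
  ring

/-- If `B` cannot offset the pre-allocation, not responding is its unique best response. -/
theorem uA_zero_lt (hMB : 0 < MB) (hcB : cB ∈ Set.Ioo (0 : ℝ) 1) {a b : ℝ}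
    (ha0 : 0 < a) (ha : cA * a < MA) (h : MB - cB * a ≤ cB * (MA - cA * a)) (hb0 : 0 < b)
    (hb : cB * b ≤ MB) : uA MA cA MB cB a 0 < uA MA cA MB cB a b := by
  have hR : 0 < MA - cA * a := sub_pos.2 ha
  have hc0 := hcB.1
  have hc1 := hcB.2
  have hlt := headStartValue_lt_offset hcB ha0 hR.le hMB h
  rw [uA_zero_right ha0.le ha.le hMB.le]
  rcases le_or_gt b a with hba | hba
  · rw [uA_of_le ha.le hb hba]
    -- The response `b` leaves the head start `a - b`; `n = MB - cB * a` is what remains after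
    -- removing all of it.
    have e1 : MB - cB * a + cB * (a - b) = MB - cB * b := by ring
    have e2 : MB - cB * a + cB * a = MB := by ring
    have := headStartValue_response (p := a - b) (a := a) (n := MB - cB * a) hR hcB
      (by linarith) (by linarith) (by linarith)
    rw [e1, e2] at this
    rcases this with h1 | ⟨h1, h2⟩
    · exact h1
    · rw [headStartValue_zero_of_le hR.le (by nlinarith)] at h2
      linarith
  · rw [uA_of_lt ha.le hb hba]
    have hn : 0 < MB - cB * a := by nlinarith
    have := headStartValue_le_of_weak (p := b - a) (x := MB - cB * b) (n := MB - cB * a)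
      (y := MA - cA * a) hcB (by linarith) (sub_nonneg.2 hb) (by ring) hn h
    linarith

/-- If `B` can offset the pre-allocation, only `0` and `pHat` can be best responses. -/
theorem min_lt_uA (hcB : cB ∈ Set.Ioo (0 : ℝ) 1) {a b : ℝ} (ha0 : 0 ≤ a) (ha : cA * a < MA)
    (h : cB * (MA - cA * a) < MB - cB * a) (hb0 : 0 ≤ b) (hb : cB * b ≤ MB)
    (hb1 : b = 0 → a = 0) (hb2 : b ≠ pHat MB cB a) :
    min (uA MA cA MB cB a 0) (offsetValue MA cA MB cB a) < uA MA cA MB cB a b := by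
  have hR : 0 < MA - cA * a := sub_pos.2 ha
  have hc0 := hcB.1
  have hc1 := hcB.2
  have hn : 0 < MB - cB * a := (mul_pos hc0 hR).trans h
  have hMB : 0 < MB := by nlinarith
  have key : ∀ q x : ℝ, 0 ≤ q → 0 ≤ x → x + cB * q = MB - cB * a →
      q ≠ pBar (MB - cB * a) cB →
      offsetValue MA cA MB cB a < 1 - headStartValue q x (MA - cA * a) := by
    intro q x hq hx hqx hne
    have := headStartValue_lt hn hcB hq hx hqx.le hR h fun hcon => hne hcon.1
    unfold offsetValue
    linarith
  rcases le_or_gt b a with hba | hba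
  · rw [uA_of_le ha.le hb hba]
    have hzero : offsetValue MA cA MB cB a < headStartValue 0 (MA - cA * a) (MB - cB * a) := by
      rw [headStartValue_zero_comm hR.le hn.le (Or.inl hR.ne')]
      -- Exact neutralization is the non-optimal investment `q = 0`.
      exact key 0 _ le_rfl hn.le (by ring) (pBar_pos hn hcB).ne
    rcases hb0.eq_or_lt with rfl | hb0
    -- For `a = 0` the response `0` is itself exact neutralization.
    · rw [hb1 rfl] at hzero ⊢
      refine (min_le_right _ _).trans_lt ?_
      simpa using hzero
    have e1 : MB - cB * a + cB * (a - b) = MB - cB * b := by ring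
    have e2 : MB - cB * a + cB * a = MB := by ring
    have := headStartValue_response (p := a - b) (a := a) (n := MB - cB * a) hR hcB
      (by linarith) (by linarith) (by linarith)
    rw [e1, e2] at this
    rcases this with h1 | ⟨h1, h2⟩
    · refine (min_le_left _ _).trans_lt ?_
      rwa [uA_zero_right ha0 ha.le hMB.le]
    · exact (min_le_right _ _).trans_lt (hzero.trans_le h2)
  · rw [uA_of_lt ha.le hb hba]
    refine (min_le_right _ _).trans_lt (key _ _ (by linarith) (sub_nonneg.2 hb) (by ring) ?_)
    intro hcon
    apply hb2
    rw [pHat_eq hcB]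
    linarith

theorem offsetValue_lt_uA_zero_zero (hMA : 0 < MA) (hcB : cB ∈ Set.Ioo (0 : ℝ) 1)
    (h : cB * MA < MB) : offsetValue MA cA MB cB 0 < uA MA cA MB cB 0 0 := by
  have hMB : 0 < MB := (mul_pos hcB.1 hMA).trans h
  have := min_lt_uA (MA := MA) (cA := cA) (MB := MB) (a := 0) (b := 0) hcB le_rfl (by simpa)
    (by simpa) le_rfl (by simpa using hMB.le) (fun _ => rfl)
    (lt_pHat hcB (by simpa using hMB)).ne
  rcases min_lt_iff.1 this with h1 | h1
  · exact absurd h1 (lt_irrefl _)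
  · exact h1

/-- The payoff that `A` secures with a pre-allocation. -/
def securedValue (MA cA MB cB a : ℝ) : ℝ := sInf (uA MA cA MB cB a '' Set.Icc 0 (MB / cB))

theorem mem_Icc_div_iff {M c q : ℝ} (hc : 0 < c) :
    q ∈ Set.Icc 0 (M / c) ↔ 0 ≤ q ∧ c * q ≤ M := by
  rw [Set.mem_Icc, le_div_iff₀ hc, mul_comm c]

theorem securedValue_le (hcB : 0 < cB) {a b : ℝ} (hb0 : 0 ≤ b) (hb : cB * b ≤ MB) :
    securedValue MA cA MB cB a ≤ uA MA cA MB cB a b :=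
  csInf_le ⟨0, by rintro _ ⟨q, -, rfl⟩; exact uA_nonneg a q⟩
    ⟨b, (mem_Icc_div_iff hcB).2 ⟨hb0, hb⟩, rfl⟩

theorem securedValue_eq_of_isMinOn {a b : ℝ} (hb : b ∈ Set.Icc 0 (MB / cB))
    (h : IsMinOn (fun q => uA MA cA MB cB a q) (Set.Icc 0 (MB / cB)) b) :
    securedValue MA cA MB cB a = uA MA cA MB cB a b :=
  IsLeast.csInf_eq ⟨⟨b, hb, rfl⟩, by rintro _ ⟨q, hq, rfl⟩; exact h hq⟩

/-- `b` is a best response of `B` to the pre-allocation `a`. -/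
def IsBestResponse (MA cA MB cB a b : ℝ) : Prop :=
  b ∈ Set.Icc 0 (MB / cB) ∧ IsMinOn (fun q => uA MA cA MB cB a q) (Set.Icc 0 (MB / cB)) b

theorem isBestResponse_iff_of_weak (hMB : 0 < MB) (hcB : cB ∈ Set.Ioo (0 : ℝ) 1) {a : ℝ}
    (ha0 : 0 < a) (ha : cA * a < MA) (h : MB - cB * a ≤ cB * (MA - cA * a)) (b : ℝ) :
    IsBestResponse MA cA MB cB a b ↔ b = 0 := by
  have hc0 := hcB.1
  have h0 : (0 : ℝ) ∈ Set.Icc 0 (MB / cB) := ⟨le_rfl, by positivity⟩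
  constructor
  · rintro ⟨hb, hmin⟩
    by_contra hne
    rw [mem_Icc_div_iff hc0] at hb
    exact absurd (hmin h0) (uA_zero_lt hMB hcB ha0 ha h (lt_of_le_of_ne hb.1 (Ne.symm hne))
      hb.2).not_ge
  · rintro rfl
    refine ⟨h0, fun q hq => ?_⟩
    rw [mem_Icc_div_iff hc0] at hq
    rcases hq.1.eq_or_lt with rfl | hq0
    · exact le_refl (uA MA cA MB cB a 0)
    · exact (uA_zero_lt hMB hcB ha0 ha h hq0 hq.2).le

theorem isBestResponse_iff_of_strong (hMB : 0 < MB) (hcB : cB ∈ Set.Ioo (0 : ℝ) 1) {a : ℝ}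
    (ha0 : 0 ≤ a) (ha : cA * a < MA) (h : cB * (MA - cA * a) < MB - cB * a) (b : ℝ) :
    IsBestResponse MA cA MB cB a b ↔
      b = 0 ∧ uA MA cA MB cB a 0 ≤ offsetValue MA cA MB cB a ∨
      b = pHat MB cB a ∧ offsetValue MA cA MB cB a ≤ uA MA cA MB cB a 0 := by
  have hc0 := hcB.1
  have hn : cB * a < MB := by nlinarith
  have h0 : (0 : ℝ) ∈ Set.Icc 0 (MB / cB) := ⟨le_rfl, by positivity⟩
  have hp : pHat MB cB a ∈ Set.Icc 0 (MB / cB) :=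
    (mem_Icc_div_iff hc0).2 ⟨ha0.trans (lt_pHat hcB hn).le, mul_pHat_le hcB hn.le⟩
  have hup := uA_pHat hcB ha.le hn h.le
  have hmin : ∀ q ∈ Set.Icc 0 (MB / cB),
      min (uA MA cA MB cB a 0) (offsetValue MA cA MB cB a) ≤ uA MA cA MB cB a q := by
    intro q hq
    rw [mem_Icc_div_iff hc0] at hq
    by_cases hq0 : q = 0
    · rw [hq0]; exact min_le_left _ _
    by_cases hqp : q = pHat MB cB a
    · rw [hqp, hup]; exact min_le_right _ _
    exact (min_lt_uA hcB ha0 ha h hq.1 hq.2 (fun h => absurd h hq0) hqp).le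
  constructor
  · rintro ⟨hb, hbmin⟩
    have e1 : uA MA cA MB cB a b ≤ uA MA cA MB cB a 0 := hbmin h0
    have e2 : uA MA cA MB cB a b ≤ uA MA cA MB cB a (pHat MB cB a) := hbmin hp
    rw [hup] at e2
    by_cases hb0 : b = 0
    · rw [hb0] at e2; exact Or.inl ⟨hb0, e2⟩
    by_cases hbp : b = pHat MB cB a
    · rw [hbp, hup] at e1; exact Or.inr ⟨hbp, e1⟩
    rw [mem_Icc_div_iff hc0] at hb
    have := min_lt_uA hcB ha0 ha h hb.1 hb.2 (fun h => absurd h hb0) hbp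
    exact absurd (le_min e1 e2) this.not_ge
  · rintro (⟨rfl, hle⟩ | ⟨rfl, hle⟩)
    · refine ⟨h0, fun q hq => ?_⟩
      have := hmin q hq
      rwa [min_eq_left hle] at this
    · refine ⟨hp, fun q hq => ?_⟩
      have := hmin q hq
      rw [min_eq_right hle, ← hup] at this
      exact this

theorem isStackelberg_iff_of_forall_lt (hcA : 0 < cA) {a : ℝ} (ha0 : 0 ≤ a) (ha : cA * a ≤ MA)
    (h : ∀ q, 0 ≤ q → cA * q ≤ MA → q ≠ a →
      securedValue MA cA MB cB q < securedValue MA cA MB cB a) (pA pB : ℝ) :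
    IsStackelberg MA cA MB cB pA pB ↔ pA = a ∧ IsBestResponse MA cA MB cB a pB := by
  have haI : a ∈ Set.Icc 0 (MA / cA) := (mem_Icc_div_iff hcA).2 ⟨ha0, ha⟩
  constructor
  · rintro ⟨⟨hpA, hmax⟩, hresp⟩
    have : pA = a := by
      by_contra hne
      rw [mem_Icc_div_iff hcA] at hpA
      exact absurd (hmax haI) (h pA hpA.1 hpA.2 hne).not_ge
    subst this
    exact ⟨rfl, hresp⟩
  · rintro ⟨rfl, hresp⟩
    refine ⟨⟨haI, fun q hq => ?_⟩, hresp⟩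
    by_cases hne : q = pA
    · rw [hne]; exact le_refl (securedValue MA cA MB cB pA)
    rw [mem_Icc_div_iff hcA] at hq
    exact (h q hq.1 hq.2 hne).le

theorem IsBestResponse.securedValue_eq {a b : ℝ} (h : IsBestResponse MA cA MB cB a b) :
    securedValue MA cA MB cB a = uA MA cA MB cB a b := securedValue_eq_of_isMinOn h.1 h.2

/-- `pBar` is the unique optimal pre-allocation if `B` does not respond. -/
theorem uA_zero_lt_pBar (hMA : 0 < MA) (hMB : 0 < MB) (hcA : cA ∈ Set.Ioo (0 : ℝ) 1)
    (h : cA * MB < MA) {q : ℝ} (hq0 : 0 ≤ q) (hq : cA * q ≤ MA) (hne : q ≠ pBar MA cA) :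
    uA MA cA MB cB q 0 < uA MA cA MB cB (pBar MA cA) 0 := by
  have hp := sub_mul_pBar_pos hMA hcA
  rw [uA_zero_right hq0 hq hMB.le,
    uA_zero_right (pBar_pos hMA hcA).le (by linarith) hMB.le, headStartValue_pBar hMA hcA h.le]
  exact headStartValue_lt hMA hcA hq0 (by linarith) (by linarith) hMB h fun hcon => hne hcon.1

theorem isOptimalInvestment_iff (hMA : 0 < MA) (hMB : 0 < MB) (hcA : cA ∈ Set.Ioo (0 : ℝ) 1)
    (h : cA * MB < MA) (P R : ℝ) : IsOptimalInvestment MA cA MB P R ↔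
      P = pBar MA cA ∧ R = MA - cA * pBar MA cA := by
  have hp := pBar_pos hMA hcA
  have hr := sub_mul_pBar_pos hMA hcA
  constructor
  · rintro ⟨⟨hP, hR, hb⟩, hopt⟩
    by_contra hne
    have h1 := hopt _ _ hp.le hr.le (by linarith)
    rw [eqPayoffA_of_nonneg hp.le hr.le hMB.le, eqPayoffA_of_nonneg hP hR hMB.le,
      headStartValue_pBar hMA hcA h.le] at h1
    exact absurd h1 (headStartValue_lt hMA hcA hP hR hb hMB h hne).not_ge
  · rintro ⟨rfl, rfl⟩
    refine ⟨⟨hp.le, hr.le, by linarith⟩, fun P' R' hP hR hb => ?_⟩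
    rw [eqPayoffA_of_nonneg hp.le hr.le hMB.le, eqPayoffA_of_nonneg hP hR hMB.le,
      headStartValue_pBar hMA hcA h.le]
    exact headStartValue_le hMA hcA hP hR hb hMB.le h

/-- An indifference threshold is a pre-allocation that `B` can offset and at which both candidate
responses give the same payoff. -/
theorem isIndifference_iff (hMA : 0 < MA) (hMB : 0 < MB) (hcA : cA ∈ Set.Ioo (0 : ℝ) 1)
    (hcB : cB ∈ Set.Ioo (0 : ℝ) 1) (h : cA * MB ≤ cB * MA) (a : ℝ) :
    IsIndifference MA cA MB cB a ↔ 0 < a ∧ cA * a < MA ∧ cB * (MA - cA * a) < MB - cB * a ∧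
      uA MA cA MB cB a 0 = offsetValue MA cA MB cB a := by
  have hA0 := hcA.1
  have hA1 := hcA.2
  have hB0 := hcB.1
  have hB1 := hcB.2
  unfold IsIndifference uB
  rw [mem_Icc_div_iff hB0, Set.mem_Ioc, le_div_iff₀ hA0, mul_comm a, sub_right_inj]
  constructor
  · rintro ⟨⟨ha0, ha⟩, ⟨hp0, hp⟩, heq⟩
    have hp1 : cB * a ≤ MB := by
      have h2 : 0 < 2 - cB := by linarith
      have h3 : cB * pHat MB cB a = MB - cB * (MB - cB * a) / (2 - cB) := by
        unfold pHat
        field_simp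
      rw [h3] at hp
      have h4 : 0 ≤ cB * (MB - cB * a) / (2 - cB) := by linarith
      rw [le_div_iff₀ h2, zero_mul] at h4
      exact sub_nonneg.1 (nonneg_of_mul_nonneg_right h4 hB0)
    rcases ha.eq_or_lt with ha1 | ha1
    -- If `A` pre-allocates everything, `pHat` equals `a` and both real-time budgets vanish: `A`
    -- wins the tie and gets `1`, but less than `1` against `0`.
    · exfalso
      have h5 : cB * a = MB := by
        refine le_antisymm hp1 (le_of_mul_le_mul_left ?_ hA0)
        calc cA * MB ≤ cB * MA := h
          _ = cA * (cB * a) := by rw [← ha1]; ring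
      have h6 : pHat MB cB a = a := by
        rw [pHat_eq hcB, h5]
        simp [pBar]
      rw [h6, uA_of_le ha hp1 le_rfl, uA_zero_right ha0.le ha hMB.le, ha1, h5, sub_self,
        sub_self, sub_self, headStartValue_zero_of_le le_rfl le_rfl, headStartValue_of_le,
        supportTop_zero_right] at heq
      · have : 0 < MB / a := by positivity
        simp only [mul_zero, div_zero, sub_zero] at heq
        linarith
      · rw [supportTop_zero_right]
        nlinarith
    · have hpp : 0 < pHat MB cB a := by
        rcases hp1.eq_or_lt with h5 | h5
        · rw [pHat_eq hcB, h5]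
          simpa [pBar] using ha0
        · exact ha0.trans (lt_pHat hcB h5)
      have hst : cB * (MA - cA * a) < MB - cB * a := by
        by_contra! hcon
        exact absurd heq (uA_zero_lt hMB hcB ha0 ha1 hcon hpp hp).ne
      refine ⟨ha0, ha1, hst, ?_⟩
      rw [heq, uA_pHat hcB ha ?_ hst.le]
      nlinarith
  · rintro ⟨ha0, ha, hst, heq⟩
    have hn : cB * a < MB := by nlinarith
    exact ⟨⟨ha0, ha.le⟩, ⟨ha0.le.trans (lt_pHat hcB hn).le, mul_pHat_le hcB hn.le⟩,
      by rw [heq, uA_pHat hcB ha.le hn hst.le]⟩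

end stackelberg

/-! ### Equilibria in each range of the parameters. -/

section equilibria

variable {MA cA MB cB : ℝ}

theorem securedValue_le_offsetValue (hcB : cB ∈ Set.Ioo (0 : ℝ) 1) {a : ℝ} (ha0 : 0 ≤ a)
    (ha : cA * a ≤ MA) (h : cB * (MA - cA * a) < MB - cB * a) :
    securedValue MA cA MB cB a ≤ offsetValue MA cA MB cB a := by
  have hn : cB * a < MB := by
    have := mul_nonneg hcB.1.le (sub_nonneg.2 ha)
    linarith
  rw [← uA_pHat hcB ha hn h.le]
  exact securedValue_le hcB.1 (ha0.trans (lt_pHat hcB hn).le) (mul_pHat_le hcB hn.le)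

theorem securedValue_le_uA_zero (hMB : 0 ≤ MB) (hcB : 0 < cB) (a : ℝ) :
    securedValue MA cA MB cB a ≤ uA MA cA MB cB a 0 :=
  securedValue_le hcB le_rfl (by simpa)

theorem uA_zero_lt_offsetValue_of_lt (hMA : 0 < MA) (hMB : 0 < MB)
    (hcA : cA ∈ Set.Ioo (0 : ℝ) 1) (hcB : cB ∈ Set.Ioo (0 : ℝ) 1) (h₁ : cB * MA < MB)
    (h₂ : cA * MB ≤ cB * MA) {x y : ℝ} (hx : 0 ≤ x) (hxy : x < y) (hyM : cA * y ≤ MA)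
    (hym : cB * y < MB) (h : uA MA cA MB cB x 0 ≤ offsetValue MA cA MB cB x) :
    uA MA cA MB cB y 0 < offsetValue MA cA MB cB y := by
  have hcxy : cA * x < cA * y := mul_lt_mul_of_pos_left hxy hcA.1
  rw [uA_zero_right hx (by linarith) hMB.le] at h
  rw [uA_zero_right (hx.trans hxy.le) hyM hMB.le]
  exact headStartValue_lt_offsetValue_of_lt hMA hMB hcA hcB h₁ h₂ hx hxy hyM hym h

theorem IsIndifference.eq (hMA : 0 < MA) (hMB : 0 < MB) (hcA : cA ∈ Set.Ioo (0 : ℝ) 1)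
    (hcB : cB ∈ Set.Ioo (0 : ℝ) 1) (h₁ : cB * MA < MB) (h₂ : cA * MB ≤ cB * MA) {x y : ℝ}
    (hx : IsIndifference MA cA MB cB x) (hy : IsIndifference MA cA MB cB y) : x = y := by
  rw [isIndifference_iff hMA hMB hcA hcB h₂] at hx hy
  obtain ⟨hx0, hxM, hxs, hxe⟩ := hx
  obtain ⟨hy0, hyM, hys, hye⟩ := hy
  have hx2 := mul_pos hcB.1 (sub_pos.2 hxM)
  have hy2 := mul_pos hcB.1 (sub_pos.2 hyM)
  rcases lt_trichotomy x y with h | h | h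
  · exact absurd hye (uA_zero_lt_offsetValue_of_lt hMA hMB hcA hcB h₁ h₂ hx0.le h hyM.le
      (by linarith) hxe.le).ne
  · exact h
  · exact absurd hxe (uA_zero_lt_offsetValue_of_lt hMA hMB hcA hcB h₁ h₂ hy0.le h hxM.le
      (by linarith) hye.le).ne

theorem exists_isIndifference (hMA : 0 < MA) (hMB : 0 < MB) (hcA : cA ∈ Set.Ioo (0 : ℝ) 1)
    (hcB : cB ∈ Set.Ioo (0 : ℝ) 1) (h₁ : cB * MA < MB) (h₂ : cA * MB < cB * MA) :
    ∃ a, IsIndifference MA cA MB cB a := by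
  obtain ⟨a, ha0, haM, hs, he⟩ := exists_headStartValue_eq_offsetValue hMA hMB hcA hcB h₁ h₂
  refine ⟨a, (isIndifference_iff hMA hMB hcA hcB h₂.le a).2 ⟨ha0, haM, hs, ?_⟩⟩
  rw [uA_zero_right ha0.le haM.le hMB.le, he]

theorem IsIndifference.isBestResponse_iff (hMA : 0 < MA) (hMB : 0 < MB)
    (hcA : cA ∈ Set.Ioo (0 : ℝ) 1) (hcB : cB ∈ Set.Ioo (0 : ℝ) 1) (h₂ : cA * MB ≤ cB * MA)
    {a : ℝ} (ha : IsIndifference MA cA MB cB a) (b : ℝ) :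
    IsBestResponse MA cA MB cB a b ↔ b = 0 ∨ b = pHat MB cB a := by
  obtain ⟨ha0, haM, hs, he⟩ := (isIndifference_iff hMA hMB hcA hcB h₂ a).1 ha
  rw [isBestResponse_iff_of_strong hMB hcB ha0.le haM hs, he]
  simp

theorem uA_zero_lt_of_pBar_le (hMA : 0 < MA) (hMB : 0 < MB) (hcA : cA ∈ Set.Ioo (0 : ℝ) 1)
    (h : cA * MB ≤ MA) {a q : ℝ} (ha : pBar MA cA ≤ a) (haq : a < q) (hq : cA * q ≤ MA) :
    uA MA cA MB cB q 0 < uA MA cA MB cB a 0 := by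
  have hp := pBar_pos hMA hcA
  have hc := mul_lt_mul_of_pos_left haq hcA.1
  rw [uA_zero_right (by linarith) hq hMB.le, uA_zero_right (by linarith) (by linarith) hMB.le]
  exact headStartValue_lt_of_pBar_le hMA hcA hMB h ha haq hq

theorem isStackelberg_iff_pBar (hMA : 0 < MA) (hMB : 0 < MB) (hcA : cA ∈ Set.Ioo (0 : ℝ) 1)
    (hcB : 0 < cB) (h : cA * MB < MA)
    (hresp : ∀ b, IsBestResponse MA cA MB cB (pBar MA cA) b ↔ b = 0) (pA pB : ℝ) :
    IsStackelberg MA cA MB cB pA pB ↔ pA = pBar MA cA ∧ pB = 0 := by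
  rw [← hresp]
  refine isStackelberg_iff_of_forall_lt hcA.1 (pBar_pos hMA hcA).le
    (by linarith [sub_mul_pBar_pos hMA hcA]) (fun q hq0 hq hne => ?_) pA pB
  rw [((hresp 0).2 rfl).securedValue_eq]
  exact (securedValue_le_uA_zero hMB.le hcB q).trans_lt
    (uA_zero_lt_pBar hMA hMB hcA h hq0 hq hne)

theorem isStackelberg_iff_of_isIndifference_lt_pBar (hMA : 0 < MA) (hMB : 0 < MB)
    (hcA : cA ∈ Set.Ioo (0 : ℝ) 1) (hcB : cB ∈ Set.Ioo (0 : ℝ) 1) (h₁ : cB * MA < MB)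
    (h₂ : cA * MB ≤ cB * MA) {a : ℝ} (ha : IsIndifference MA cA MB cB a)
    (hlt : a < pBar MA cA) (pA pB : ℝ) :
    IsStackelberg MA cA MB cB pA pB ↔ pA = pBar MA cA ∧ pB = 0 := by
  obtain ⟨ha0, -, -, he⟩ := (isIndifference_iff hMA hMB hcA hcB h₂ a).1 ha
  have hpM : cA * pBar MA cA < MA := sub_pos.1 (sub_mul_pBar_pos hMA hcA)
  have hp := pBar_pos hMA hcA
  have hcB1 : cB * MA < MA := mul_lt_of_lt_one_left hMA hcB.2
  refine isStackelberg_iff_pBar hMA hMB hcA hcB.1 (by linarith) (fun b => ?_) pA pB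
  rcases le_or_gt (MB - cB * pBar MA cA) (cB * (MA - cA * pBar MA cA)) with h | h
  · exact isBestResponse_iff_of_weak hMB hcB hp hpM h b
  · have hn := mul_pos hcB.1 (sub_pos.2 hpM)
    have := uA_zero_lt_offsetValue_of_lt hMA hMB hcA hcB h₁ h₂ ha0.le hlt hpM.le
      (by linarith) he.le
    rw [isBestResponse_iff_of_strong hMB hcB hp.le hpM h]
    simp [this.le, this.not_ge]

theorem isStackelberg_iff_of_pBar_le_isIndifference (hMA : 0 < MA) (hMB : 0 < MB)
    (hcA : cA ∈ Set.Ioo (0 : ℝ) 1) (hcB : cB ∈ Set.Ioo (0 : ℝ) 1)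
    (h₂ : cA * MB < cB * MA) {a : ℝ} (ha : IsIndifference MA cA MB cB a)
    (hle : pBar MA cA ≤ a) (pA pB : ℝ) :
    IsStackelberg MA cA MB cB pA pB ↔ pA = a ∧ (pB = 0 ∨ pB = pHat MB cB a) := by
  have hresp := ha.isBestResponse_iff hMA hMB hcA hcB h₂.le
  obtain ⟨ha0, haM, hs, he⟩ := (isIndifference_iff hMA hMB hcA hcB h₂.le a).1 ha
  have hcB1 : cB * MA < MA := mul_lt_of_lt_one_left hMA hcB.2
  rw [← hresp]
  refine isStackelberg_iff_of_forall_lt hcA.1 ha0.le haM.le (fun q hq0 hq hne => ?_) pA pB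
  rw [((hresp 0).2 (Or.inl rfl)).securedValue_eq]
  -- Below `a` the secured value is at most the increasing `offsetValue`; above `a ≥ pBar` it is at
  -- most the decreasing `uA q 0`.
  rcases lt_or_gt_of_ne hne with h | h
  · have h1 : cB * (1 - cA) * q < cB * (1 - cA) * a :=
      mul_lt_mul_of_pos_left h (mul_pos hcB.1 (by linarith [hcA.2]))
    have hqs : cB * (MA - cA * q) < MB - cB * q := by linarith
    refine (securedValue_le_offsetValue hcB hq0 hq hqs).trans_lt ?_
    have hn := mul_pos hcB.1 (sub_pos.2 haM)
    have hn' := mul_nonneg hcB.1.le (sub_nonneg.2 hq)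
    rw [he, offsetValue_lt_iff hcB (by linarith) (by linarith)]
    exact mul_pos (by linarith) (by linarith)
  · exact (securedValue_le_uA_zero hMB.le hcB.1 q).trans_lt
      (uA_zero_lt_of_pBar_le hMA hMB hcA (by linarith) hle h hq)

theorem IsIndifference.isStackelberg_of_eq (hMA : 0 < MA) (hMB : 0 < MB)
    (hcA : cA ∈ Set.Ioo (0 : ℝ) 1) (hcB : cB ∈ Set.Ioo (0 : ℝ) 1) (h₁ : cB * MA < MB)
    (h₂ : cA * MB = cB * MA) {a : ℝ} (ha : IsIndifference MA cA MB cB a) :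
    pBar MA cA ≤ a ∧ ∀ b, b = 0 ∨ b = pHat MB cB a → IsStackelberg MA cA MB cB a b := by
  have hresp := ha.isBestResponse_iff hMA hMB hcA hcB h₂.le
  obtain ⟨ha0, haM, hs, he⟩ := (isIndifference_iff hMA hMB hcA hcB h₂.le a).1 ha
  have hcB1 : cB * MA < MA := mul_lt_of_lt_one_left hMA hcB.2
  have hstrong : ∀ q, cA * q < MA → cB * q < MB ∧ cB * (MA - cA * q) < MB - cB * q := by
    intro q hq
    have h3 : 0 < cB * (MA - cA * q) := mul_pos hcB.1 (sub_pos.2 hq)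
    have h4 : 0 < cB * (MA - cA * q) * (1 - cA) := mul_pos h3 (by linarith [hcA.2])
    refine ⟨lt_of_mul_lt_mul_left ?_ hcA.1.le, lt_of_mul_lt_mul_left ?_ hcA.1.le⟩ <;> linarith
  have hconst : ∀ q, cA * q < MA → offsetValue MA cA MB cB q ≤ offsetValue MA cA MB cB a := by
    intro q hq
    rw [offsetValue_le_iff hcB (hstrong q hq).1 (hstrong a haM).1, h₂, sub_self, mul_zero]
  have hle : pBar MA cA ≤ a := by
    -- If `a < pBar`, then `B` would offset at `pBar`, where `uA` against `0` drops below the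
    -- constant `offsetValue`, although `pBar` maximizes it.
    by_contra! hlt
    have hpM : cA * pBar MA cA < MA := sub_pos.1 (sub_mul_pBar_pos hMA hcA)
    have h3 := uA_zero_lt_offsetValue_of_lt hMA hMB hcA hcB h₁ h₂.le ha0.le hlt hpM.le
      (hstrong _ hpM).1 he.le
    have h4 := uA_zero_lt_pBar (cB := cB) hMA hMB hcA (by linarith) ha0.le haM.le hlt.ne
    linarith [hconst _ hpM]
  refine ⟨hle, fun b hb => ⟨⟨(mem_Icc_div_iff hcA.1).2 ⟨ha0.le, haM.le⟩, fun q hq => ?_⟩,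
    (hresp b).2 hb⟩⟩
  change securedValue MA cA MB cB q ≤ securedValue MA cA MB cB a
  rw [mem_Icc_div_iff hcA.1] at hq
  rw [((hresp 0).2 (Or.inl rfl)).securedValue_eq]
  rcases hq.2.lt_or_eq with hqM | hqM
  · rw [he]
    exact (securedValue_le_offsetValue hcB hq.1 hq.2 (hstrong q hqM).2).trans (hconst q hqM)
  · have haq : a < q := lt_of_mul_lt_mul_left (by rwa [hqM]) hcA.1.le
    exact (securedValue_le_uA_zero hMB.le hcB.1 q).trans
      (uA_zero_lt_of_pBar_le hMA hMB hcA (by linarith) hle haq hq.2).le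

/-- `offsetValue` is strictly decreasing in this range and bounds the secured value everywhere; at
`0` the bound is attained, by `pHat` only. -/
theorem isStackelberg_iff_of_strong (hMA : 0 < MA) (hMB : 0 < MB)
    (hcA : cA ∈ Set.Ioo (0 : ℝ) 1) (hcB : cB ∈ Set.Ioo (0 : ℝ) 1) (h : cB * MA < cA * MB)
    (pA pB : ℝ) : IsStackelberg MA cA MB cB pA pB ↔ pA = 0 ∧ pB = pHat MB cB 0 := by
  have hcA1 : cA * MB < MB := mul_lt_of_lt_one_left hMB hcA.2
  have hlt := offsetValue_lt_uA_zero_zero (cA := cA) hMA hcB (h.trans hcA1)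
  have hresp : ∀ b, IsBestResponse MA cA MB cB 0 b ↔ b = pHat MB cB 0 := by
    intro b
    rw [isBestResponse_iff_of_strong hMB hcB le_rfl (by simpa) (by simpa using h.trans hcA1)]
    simp [hlt.le, hlt.not_ge]
  rw [← hresp]
  refine isStackelberg_iff_of_forall_lt hcA.1 le_rfl (by simpa using hMA.le)
    (fun q hq0 hq hne => ?_) pA pB
  have hq1 : 0 < q := lt_of_le_of_ne hq0 hne.symm
  have hn' := mul_nonneg hcB.1.le (sub_nonneg.2 hq)
  have hqs : cB * (MA - cA * q) < MB - cB * q := by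
    refine lt_of_mul_lt_mul_left ?_ hcA.1.le
    nlinarith [mul_nonneg hn' (sub_nonneg.2 hcA.2.le)]
  rw [((hresp _).2 rfl).securedValue_eq,
    uA_pHat hcB (by simpa using hMA.le) (by simpa) (by simpa using (h.trans hcA1).le)]
  refine (securedValue_le_offsetValue hcB hq0 hq hqs).trans_lt ?_
  rw [offsetValue_lt_iff hcB (by linarith) (by simpa)]
  exact mul_pos_of_neg_of_neg (by linarith) (by linarith)

end equilibria

end Lotto

end

theorem mainTheorem4 (MA MB cA cB : ℝ) (hMA : 0 < MA) (hMB : 0 < MB)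
    (hcA : cA ∈ Set.Ioo (0 : ℝ) 1) (hcB : cB ∈ Set.Ioo (0 : ℝ) 1) :
    -- without a response of B, the unique optimal investment of A has pre-allocation `pBar`
    (MB / cB ≤ MA / cA → ∀ P R : ℝ, Lotto.IsOptimalInvestment MA cA MB P R ↔
      P = Lotto.pBar MA cA ∧ R = MA - cA * Lotto.pBar MA cA) ∧
    -- 1. B is weak
    (MB / cB ≤ MA → ∀ pA pB : ℝ, Lotto.IsStackelberg MA cA MB cB pA pB ↔
      pA = Lotto.pBar MA cA ∧ pB = 0) ∧
    -- 2. the middle range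
    (MA < MB / cB → MB / cB < MA / cA →
      ∃ pd : ℝ, (∀ q : ℝ, Lotto.IsIndifference MA cA MB cB q ↔ q = pd) ∧
        (pd < Lotto.pBar MA cA → ∀ pA pB : ℝ, Lotto.IsStackelberg MA cA MB cB pA pB ↔
          pA = Lotto.pBar MA cA ∧ pB = 0) ∧
        (Lotto.pBar MA cA ≤ pd → ∀ pA pB : ℝ, Lotto.IsStackelberg MA cA MB cB pA pB ↔
          pA = pd ∧ (pB = 0 ∨ pB = Lotto.pHat MB cB pd))) ∧
    -- 2'. the upper end of the middle range
    (MB / cB = MA / cA → ∀ pd : ℝ, Lotto.IsIndifference MA cA MB cB pd →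
      (∀ q : ℝ, Lotto.IsIndifference MA cA MB cB q → q = pd) ∧
      Lotto.pBar MA cA ≤ pd ∧
      Lotto.IsStackelberg MA cA MB cB pd 0 ∧
      Lotto.IsStackelberg MA cA MB cB pd (Lotto.pHat MB cB pd)) ∧
    -- 3. B is strong
    (MA / cA < MB / cB → ∀ pA pB : ℝ, Lotto.IsStackelberg MA cA MB cB pA pB ↔
      pA = 0 ∧ pB = Lotto.pHat MB cB 0) := by
  have hA0 := hcA.1
  have hB0 := hcB.1
  have hcB1 : cB * MA < MA := mul_lt_of_lt_one_left hMA hcB.2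
  refine ⟨fun h => ?_, fun h => ?_, fun h₁ h₂ => ?_, fun h pd hpd => ?_, fun h => ?_⟩
  · rw [div_le_div_iff₀ hB0 hA0] at h
    exact Lotto.isOptimalInvestment_iff hMA hMB hcA (by linarith)
  · rw [div_le_iff₀ hB0] at h
    have hpM := Lotto.sub_mul_pBar_pos hMA hcA
    have hp := Lotto.pBar_pos hMA hcA
    have h1 : cA * MB ≤ 1 * MB := by gcongr; exact hcA.2.le
    refine Lotto.isStackelberg_iff_pBar hMA hMB hcA hB0 (by linarith) fun b =>
      Lotto.isBestResponse_iff_of_weak hMB hcB hp (by linarith) ?_ b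
    have : 0 ≤ cB * (1 - cA) * Lotto.pBar MA cA :=
      mul_nonneg (mul_nonneg hB0.le (by linarith [hcA.2])) hp.le
    linarith
  · rw [lt_div_iff₀ hB0] at h₁
    rw [div_lt_div_iff₀ hB0 hA0] at h₂
    have h₁' : cB * MA < MB := by linarith
    have h₂' : cA * MB < cB * MA := by linarith
    obtain ⟨pd, hpd⟩ := Lotto.exists_isIndifference hMA hMB hcA hcB h₁' h₂'
    refine ⟨pd, fun q => ⟨fun hq => hq.eq hMA hMB hcA hcB h₁' h₂'.le hpd, ?_⟩, fun hlt => ?_,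
      fun hle => ?_⟩
    · rintro rfl
      exact hpd
    · exact Lotto.isStackelberg_iff_of_isIndifference_lt_pBar hMA hMB hcA hcB h₁' h₂'.le hpd hlt
    · exact Lotto.isStackelberg_iff_of_pBar_le_isIndifference hMA hMB hcA hcB h₂' hpd hle
  · rw [div_eq_div_iff hB0.ne' hA0.ne'] at h
    have h₂ : cA * MB = cB * MA := by linarith
    have h₁ : cB * MA < MB := h₂ ▸ mul_lt_of_lt_one_left hMB hcA.2
    obtain ⟨hle, hst⟩ := hpd.isStackelberg_of_eq hMA hMB hcA hcB h₁ h₂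
    exact ⟨fun q hq => hq.eq hMA hMB hcA hcB h₁ h₂.le hpd, hle, hst _ (Or.inl rfl),
      hst _ (Or.inr rfl)⟩
  · rw [div_lt_div_iff₀ hA0 hB0] at h
    exact Lotto.isStackelberg_iff_of_strong hMA hMB hcA hcB (by linarith)
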